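/- Let $d\ge 1$, $n\ge 2$, and let $\mathbb{Z}_n^d=(\mathbb{Z}/n\mathbb{Z})^d$ be the discrete torus with graph Laplacian $$\Delta_g f(x)=\frac1{2d}\sum_{i=1}^d\bigl(f(x+e_i)+f(x-e_i)-2f(x)\bigr).$$ Let $(\sigma(x))_{x\in\mathbb{Z}_n^d}$ be i.i.d. standard Gaussian random variables, and consider the divisible sandpile with nearest-neighbour redistribution and initial configuration $$s(x)=1+\sigma(x)-\frac1{n^d}\sum_{y\in\mathbb{Z}_n^d}\sigma(y):$$ set $s_0=s$, $e_t(x)=(s_t(x)-1)^+$, $s_{t+1}=s_t+\Delta_g e_t$, and let $u_\infty(x)=\sum_{t\ge0}e_t(x)\in[0,\infty]$ be the odometer, i.e. the total mass emitted from $x$. Put $$\phi_d(n)=\begin{cases}n^{2-d/2},&d<4,\\ \log n,&d=4,\\ (\log n)^{1/2},&d\ge5.\end{cases}$$ Then there is a constant $C_d>0$, depending only on $d$, such that for all $n\ge2$ and all $x\in\mathbb{Z}_n^d$ $$C_d^{-1}\,\phi_d(n)\le \mathbb{E}\bigl(u_\infty(x)\bigr)\le C_d\,\phi_d(n).$$ Moreover,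 let $\eta(x)=\sum_{y}g(x,y)(s(y)-1)$, where $g(x,y)=n^{-d}\sum_{z}g_z(x,y)$ and $g_z(x,y)$ is the expected number of visits to $y$ of the simple random walk on $\mathbb{Z}_n^d$ started at $x$ before it first hits $z$. Then $\max_x\eta(x)$ is integrable and $$C_d^{-1}\,\phi_d(n)\le \mathbb{E}\Bigl(\max_{x\in\mathbb{Z}_n^d}\eta(x)\Bigr)\le C_d\,\phi_d(n).$$ The same holds, with the same constant, for every discrete bi-Laplacian field $\eta$ on $\mathbb{Z}_n^d$, that is, every centred jointly Gaussian family $(\eta(x))_{x\in\mathbb{Z}_n^d}$ whose covariance $f(x,y)=\mathbb{E}(\eta(x)\eta(y))$ satisfies $(-\Delta_g)^2f(\cdot,y)=\delta_y-n^{-d}$ for every $y$. -/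

import Mathlib

open MeasureTheory ProbabilityTheory
open scoped ENNReal

namespace Sandpile

/-- The discrete torus `ℤ_n^d` of side length `n`. -/
abbrev Torus (d n : ℕ) : Type := Fin d → ZMod n

/-- The `2d` unit steps `± e_i` on the torus. -/
def unitStep {d n : ℕ} (a : Fin d × Bool) : Torus d n :=
  if a.2 then Pi.single a.1 1 else -Pi.single a.1 1

/-- The graph Laplacian `Δ_g f(x) = (1 / 2d) ∑_{y ∼ x} (f(y) - f(x))`. -/
noncomputable def lap {d n : ℕ} (f : Torus d n → ℝ) (x : Torus d n) : ℝ :=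
  1 / (2 * (d : ℝ)) * ∑ a : Fin d × Bool, (f (x + unitStep a) - f x)

/-! ### The divisible sandpile with nearest-neighbour redistribution -/

/-- The sandpile after `t` parallel topplings: every site keeps mass at most `1` and sends its
excess `(s_t(x) - 1)⁺` in equal parts to its neighbours.  (Once all sites are stable nothing
moves any more, so there is no need to stop.) -/
noncomputable def config {d n : ℕ} (s : Torus d n → ℝ) : ℕ → Torus d n → ℝ
  | 0 => s
  | t + 1 => fun x => config s t x + lap (fun y => max (config s t y - 1) 0) x

/-- The mass `e_t(x) = (s_t(x) - 1)⁺` emitted from `x` in the toppling after time `t`. -/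
noncomputable def emitted {d n : ℕ} (s : Torus d n → ℝ) (t : ℕ) (x : Torus d n) : ℝ :=
  max (config s t x - 1) 0

/-- The odometer `u_t(x) = ∑_{i < t} e_i(x)`. -/
noncomputable def odometer {d n : ℕ} (s : Torus d n → ℝ) (t : ℕ) (x : Torus d n) : ℝ :=
  ∑ i ∈ Finset.range t, emitted s i x

/-- The limit odometer `u_∞(x) = lim_t u_t(x) = sup_t u_t(x) ∈ [0, ∞]`
(`u_t(x)` is nonnegative and nondecreasing in `t`). -/
noncomputable def odometerLimit {d n : ℕ} (s : Torus d n → ℝ) (x : Torus d n) : ℝ≥0∞ :=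
  ⨆ t : ℕ, ENNReal.ofReal (odometer s t x)

/-- The initial configuration `s(x) = 1 + σ(x) - n^{-d} ∑_y σ(y)`. -/
noncomputable def initialConfig {d n : ℕ} [NeZero n] (σ : Torus d n → ℝ) (x : Torus d n) : ℝ :=
  1 + σ x - 1 / (n : ℝ) ^ d * ∑ y : Torus d n, σ y

/-! ### Green's function of the simple random walk and the field `η` -/

/-- The position after `r` steps of the walk started at `x` whose first `t` steps are given by `w`
(used for `r ≤ t`). -/
def walk {d n t : ℕ} (x : Torus d n) (w : Fin t → Fin d × Bool) (r : ℕ) : Torus d n :=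
  x + ∑ i : Fin t, if (i : ℕ) < r then unitStep (w i) else 0

open Classical in
/-- `P_x(X_t = y, t < τ_z)` for the simple random walk `X` on the torus and
`τ_z = inf {r ≥ 0 : X_r = z}`: the first `t` steps of the walk are uniformly distributed over the
`(2d)^t` step sequences. -/
noncomputable def killedProb {d n : ℕ} (z : Torus d n) (t : ℕ) (x y : Torus d n) : ℝ :=
  (Finset.card {w : Fin t → Fin d × Bool | walk x w t = y ∧ ∀ r ≤ t, walk x w r ≠ z} : ℝ)
    / (2 * (d : ℝ)) ^ t

/-- `g_z(x, y) = E_x[∑_{t < τ_z} 1{X_t = y}]`: the expected number of visits to `y` of the walk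
from `x` before it is killed at `z`. -/
noncomputable def killedGreen {d n : ℕ} (z x y : Torus d n) : ℝ :=
  ∑' t : ℕ, killedProb z t x y

/-- `g(x, y) = n^{-d} ∑_z g_z(x, y)`. -/
noncomputable def green {d n : ℕ} [NeZero n] (x y : Torus d n) : ℝ :=
  1 / (n : ℝ) ^ d * ∑ z : Torus d n, killedGreen z x y

/-- `η(x) = ∑_y g(x, y) (s(y) - 1)`. -/
noncomputable def etaField {d n : ℕ} [NeZero n] (s : Torus d n → ℝ) (x : Torus d n) : ℝ :=
  ∑ y : Torus d n, green x y * (s y - 1)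

/-- `η` is a discrete bi-Laplacian field: a centred jointly Gaussian family on the torus whose
covariance `f(x, y) = E[η(x) η(y)]` solves `(-Δ_g)² f(·, y) = δ_y - n^{-d}` for every `y`. -/
structure IsBiLaplacianField {d n : ℕ} [NeZero n] {Ω : Type*} [MeasurableSpace Ω]
    (η : Torus d n → Ω → ℝ) (P : Measure Ω) : Prop where
  gaussian : HasGaussianLaw (fun ω => fun x => η x ω) P
  centred : ∀ x, ∫ ω, η x ω ∂P = 0
  bilaplace : ∀ x y,
    lap (fun x' => lap (fun x'' => ∫ ω, η x'' ω * η y ω ∂P) x') x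
      = (if x = y then 1 else 0) - 1 / (n : ℝ) ^ d

/-- `φ_d(n)`: `n^{2 - d/2}` for `d < 4`, `log n` for `d = 4`, `(log n)^{1/2}` for `d ≥ 5`. -/
noncomputable def phi (d n : ℕ) : ℝ :=
  if d < 4 then (n : ℝ) ^ (2 - (d : ℝ) / 2)
  else if d = 4 then Real.log n
  else Real.log n ^ (1 / 2 : ℝ)

end Sandpile

/-! Total mass is conserved and equals n^d, so a stable limit must be the constant 1. Hence the
odometer is v - min v for any v with s + Δv = 1 (`odometerLimit_eq`). The field η is such a v and is
a bi-Laplacian field (`isBiLaplacianField_etaField`). As η is centred and -η is again a bi-Laplacian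
field, E u_∞(x) is the expected maximum of -η (`lintegral_sub_iInf`). It remains to estimate
expected maxima of bi-Laplacian fields.

The covariance equation has solutions only up to additive constants, but increments are determined:
E(η(x) - η(y))² = 2(G(0) - G(x - y)), where G = `kern d n 2` is the Fourier kernel of (-Δ)^{-2} on
mean-zero functions (`integral_sub_sq`).

Upper bounds. G(0) is O(log n) for d = 4 and O(1) for d ≥ 5, so the Gaussian maximal inequality over
n^d points gives log n and √(log n). For d ≤ 3 that inequality would lose a factor √(log n); dyadic
chaining with a Hölder bound on G removes it (`integral_iSup_le_of_le_three`).

Lower bounds. The maximum over two opposite points already has mean of order n^{2-d/2}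
(`integral_iSup_ge`), which suffices for d ≤ 3 and for bounded n. For d ≥ 4 and n large, take
translates ψ_k of a bump, centred at x_k, whose Laplacians have disjoint supports and energy τ =
∑(Δψ_k)². The variables ⟨Δ²ψ_k, η⟩/√τ are i.i.d. standard Gaussians; apart from a common centred
term, η(x_k) is the k-th of them times 1/√τ plus an independent centred remainder, which by Jensen
can only increase the expected maximum (`integral_iSup_ge_of_bumps`). With M bumps this gives √(log
M / τ) up to constants. For d ≥ 5 the bump is a point mass, with τ bounded; for d = 4 it is a
logarithmic cut-off at scale √n, with τ of order 1/log n. -/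

namespace Sandpile

/-! ### The Laplacian on the torus: summation by parts and harmonic functions. -/

section Laplacian

variable {d n : ℕ}

lemma unitStep_not (i : Fin d) (b : Bool) :
    (unitStep (i, !b) : Torus d n) = -unitStep (i, b) := by
  cases b <;> simp [unitStep]

lemma lap_add (f g : Torus d n → ℝ) (x : Torus d n) :
    lap (fun y => f y + g y) x = lap f x + lap g x := by
  simp only [lap, ← mul_add, ← Finset.sum_add_distrib]
  congr 1; exact Finset.sum_congr rfl fun a _ => by ring

lemma lap_const_mul (c : ℝ) (f : Torus d n → ℝ) (x : Torus d n) :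
    lap (fun y => c * f y) x = c * lap f x := by
  simp only [lap, Finset.mul_sum]
  exact Finset.sum_congr rfl fun a _ => by ring

lemma lap_mul_const (c : ℝ) (f : Torus d n → ℝ) (x : Torus d n) :
    lap (fun y => f y * c) x = lap f x * c := by
  simp only [mul_comm _ c, lap_const_mul]

lemma lap_const (c : ℝ) (x : Torus d n) : lap (fun _ => c) x = 0 := by simp [lap]

lemma lap_sub (f g : Torus d n → ℝ) (x : Torus d n) :
    lap (fun y => f y - g y) x = lap f x - lap g x := by
  have := lap_add f (fun y => (-1) * g y) x
  rw [lap_const_mul] at this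
  simpa [← sub_eq_add_neg] using this

lemma lap_neg (f : Torus d n → ℝ) (x : Torus d n) :
    lap (fun y => -f y) x = -lap f x := by
  simpa using lap_const_mul (-1) f x

lemma lap_add_const (f : Torus d n → ℝ) (c : ℝ) (x : Torus d n) :
    lap (fun y => f y + c) x = lap f x := by
  rw [lap_add, lap_const, add_zero]

lemma lap_sum {ι : Type*} (s : Finset ι) (f : ι → Torus d n → ℝ) (x : Torus d n) :
    lap (fun y => ∑ i ∈ s, f i y) x = ∑ i ∈ s, lap (f i) x := by
  simp only [lap, ← Finset.mul_sum]
  rw [Finset.sum_comm]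
  simp [Finset.sum_sub_distrib]

lemma lap_comp_sub (f : Torus d n → ℝ) (z x : Torus d n) :
    lap (fun y => f (y - z)) x = lap f (x - z) := by
  simp [lap, sub_add_eq_add_sub]

lemma sum_unitStep_neg {M : Type*} [AddCommMonoid M] (F : Torus d n → M) :
    ∑ a : Fin d × Bool, F (-unitStep a) = ∑ a : Fin d × Bool, F (unitStep a) := by
  simp only [Fintype.sum_prod_type, Fintype.sum_bool]
  refine Finset.sum_congr rfl fun i _ => ?_
  simp [unitStep, add_comm]

variable [NeZero n]

lemma sum_lap_mul (f g : Torus d n → ℝ) :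
    ∑ x, lap f x * g x = ∑ x, f x * lap g x := by
  have key : ∑ x, ∑ a : Fin d × Bool, f (x + unitStep a) * g x
      = ∑ x, ∑ a : Fin d × Bool, f x * g (x + unitStep a) := by
    rw [Finset.sum_comm, Finset.sum_comm (f := fun x (a : Fin d × Bool) => f x * g (x + unitStep a)),
      ← sum_unitStep_neg (fun s => ∑ x, f x * g (x + s))]
    refine Finset.sum_congr rfl fun a _ => ?_
    exact Fintype.sum_equiv (Equiv.addRight (unitStep a)) _ _ (by simp)
  have h1 : ∀ x, lap f x * g x = 1 / (2 * (d : ℝ)) *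
      (∑ a : Fin d × Bool, f (x + unitStep a) * g x - ∑ a : Fin d × Bool, f x * g x) := by
    intro x
    rw [lap, mul_assoc, Finset.sum_mul, ← Finset.sum_sub_distrib]
    simp [sub_mul]
  have h2 : ∀ x, f x * lap g x = 1 / (2 * (d : ℝ)) *
      (∑ a : Fin d × Bool, f x * g (x + unitStep a) - ∑ a : Fin d × Bool, f x * g x) := by
    intro x
    rw [lap, mul_left_comm, Finset.mul_sum, ← Finset.sum_sub_distrib]
    simp [mul_sub]
  simp only [h1, h2, ← Finset.mul_sum, Finset.sum_sub_distrib, key]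

lemma sum_lap (f : Torus d n → ℝ) : ∑ x, lap f x = 0 := by
  simpa [lap_const] using sum_lap_mul f (fun _ => 1)

lemma sum_lap_mul_self (f : Torus d n → ℝ) :
    ∑ x, f x * lap f x =
      -(1 / (4 * (d : ℝ)) * ∑ x, ∑ a : Fin d × Bool, (f (x + unitStep a) - f x) ^ 2) := by
  have h : ∀ x, ∑ a : Fin d × Bool, (f (x + unitStep a) - f x) ^ 2 =
      2 * d * lap (fun y => f y * f y) x - 4 * d * (f x * lap f x) := by
    intro x
    rcases Nat.eq_zero_or_pos d with rfl | hd
    · simp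
    have hd' : (d : ℝ) ≠ 0 := by positivity
    simp only [lap]
    field_simp
    simp only [Finset.sum_mul, Finset.mul_sum, ← Finset.sum_sub_distrib]
    refine Finset.sum_congr rfl fun a _ => by ring
  rcases Nat.eq_zero_or_pos d with rfl | hd
  · simp [lap]
  have hd' : (d : ℝ) ≠ 0 := by positivity
  simp only [h, Finset.sum_sub_distrib, ← Finset.mul_sum, sum_lap]
  field_simp
  ring

lemma eq_of_forall_unitStep {α : Type*} (f : Torus d n → α)
    (h : ∀ x i, f (x + Pi.single i 1) = f x) (x y : Torus d n) : f x = f y := by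
  have h1 : ∀ (k : ℕ) i x, f (x + Pi.single i (k : ZMod n)) = f x := by
    intro k i
    induction k with
    | zero => simp
    | succ k ih =>
      intro x
      rw [Nat.cast_succ, Pi.single_add, ← add_assoc, h, ih]
  have h2 : ∀ (s : Finset (Fin d)) (v x : Torus d n),
      f (x + ∑ i ∈ s, Pi.single i (v i)) = f x := by
    intro s v
    induction s using Finset.induction_on with
    | empty => simp
    | insert i s hi ih =>
      intro x
      rw [Finset.sum_insert hi, ← add_assoc, ih]
      simpa using h1 (v i).val i x
  have := h2 Finset.univ (y - x) x
  rw [Finset.univ_sum_single] at this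
  simpa using this.symm

/-- The Dirichlet energy of `f` vanishes, so `f` is constant along edges, and the torus is
connected. -/
lemma eq_of_lap_eq_zero (hd : 1 ≤ d) {f : Torus d n → ℝ} (h : ∀ x, lap f x = 0)
    (x y : Torus d n) : f x = f y := by
  have h1 := sum_lap_mul_self f
  simp only [h, mul_zero, Finset.sum_const_zero] at h1
  have hd' : (0 : ℝ) < d := by exact_mod_cast hd
  have h2 : ∑ x, ∑ a : Fin d × Bool, (f (x + unitStep a) - f x) ^ 2 = 0 := by
    have : 1 / (4 * (d : ℝ)) ≠ 0 := by positivity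
    rw [eq_comm, neg_eq_zero] at h1
    exact (mul_eq_zero.1 h1).resolve_left this
  refine eq_of_forall_unitStep f (fun x i => ?_) x y
  rw [Finset.sum_eq_zero_iff_of_nonneg (fun x _ => Finset.sum_nonneg fun a _ => sq_nonneg _)] at h2
  have h3 := h2 x (Finset.mem_univ x)
  rw [Finset.sum_eq_zero_iff_of_nonneg (fun a _ => sq_nonneg _)] at h3
  have h4 := h3 (i, true) (Finset.mem_univ _)
  simpa [unitStep, sub_eq_zero] using h4

/-- By self-adjointness ∑(Δf)² = ∑ f Δ²f = 0. -/
lemma lap_eq_zero_of_lap_lap_eq_zero {f : Torus d n → ℝ} (h : ∀ x, lap (lap f) x = 0)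
    (x : Torus d n) : lap f x = 0 := by
  have h1 := sum_lap_mul f (lap f)
  simp only [h, mul_zero, Finset.sum_const_zero] at h1
  rw [Finset.sum_eq_zero_iff_of_nonneg (fun x _ => mul_self_nonneg _)] at h1
  simpa using h1 x (Finset.mem_univ x)

lemma card_torus : (Fintype.card (Torus d n) : ℝ) = (n : ℝ) ^ d := by
  simp [ZMod.card]

end Laplacian

/-! ### Characters, the symbol of -Δ, and the kernels of its inverse powers. -/

section Fourier

variable {d n : ℕ} [NeZero n]

/-- The real part of the character of the torus with frequency `ξ`. -/
noncomputable def chi (ξ x : Torus d n) : ℝ := (ZMod.stdAddChar (∑ i, ξ i * x i) : ℂ).re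

/-- The eigenvalue of `-Δ_g` at frequency `ξ`. -/
noncomputable def symb (ξ : Torus d n) : ℝ :=
  1 / (d : ℝ) * ∑ i, (1 - (ZMod.stdAddChar (ξ i) : ℂ).re)

/-- The sup-norm distance from `x` to the origin of the torus. -/
def rad (x : Torus d n) : ℕ := Finset.univ.sup fun i => (x i).valMinAbs.natAbs

lemma re_stdAddChar_intCast (k : ℤ) :
    (ZMod.stdAddChar (k : ZMod n) : ℂ).re = Real.cos (2 * Real.pi * k / n) := by
  rw [ZMod.stdAddChar_coe]
  have : (2 * (Real.pi : ℂ) * Complex.I * k / n) = ((2 * Real.pi * k / n : ℝ) : ℂ) * Complex.I := by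
    push_cast; ring
  rw [this, Complex.exp_ofReal_mul_I_re]

lemma re_stdAddChar_neg (k : ZMod n) :
    (ZMod.stdAddChar (-k) : ℂ).re = (ZMod.stdAddChar k : ℂ).re := by
  obtain ⟨k, rfl⟩ := ZMod.intCast_surjective k
  rw [← Int.cast_neg, re_stdAddChar_intCast, re_stdAddChar_intCast, ← Real.cos_neg]
  congr 1; push_cast; ring

lemma re_stdAddChar_add_add_sub (a b : ZMod n) :
    (ZMod.stdAddChar (a + b) : ℂ).re + (ZMod.stdAddChar (a - b) : ℂ).re =
      2 * (ZMod.stdAddChar a : ℂ).re * (ZMod.stdAddChar b : ℂ).re := by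
  obtain ⟨a, rfl⟩ := ZMod.intCast_surjective a
  obtain ⟨b, rfl⟩ := ZMod.intCast_surjective b
  rw [← Int.cast_add, ← Int.cast_sub]
  simp only [re_stdAddChar_intCast]
  have h1 : (2 * Real.pi * ((a + b : ℤ) : ℝ) / n) = 2 * Real.pi * a / n + 2 * Real.pi * b / n := by
    push_cast; ring
  have h2 : (2 * Real.pi * ((a - b : ℤ) : ℝ) / n) = 2 * Real.pi * a / n - 2 * Real.pi * b / n := by
    push_cast; ring
  rw [h1, h2, Real.cos_add, Real.cos_sub]; ring

lemma chi_zero_right (ξ : Torus d n) : chi ξ 0 = 1 := by simp [chi]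

lemma chi_zero_left (x : Torus d n) : chi 0 x = 1 := by simp [chi]

lemma chi_neg (ξ x : Torus d n) : chi ξ (-x) = chi ξ x := by
  simp [chi, re_stdAddChar_neg]

lemma chi_le_one (ξ x : Torus d n) : chi ξ x ≤ 1 := by
  unfold chi
  obtain ⟨k, hk⟩ := ZMod.intCast_surjective (∑ i, ξ i * x i)
  rw [← hk, re_stdAddChar_intCast]
  exact Real.cos_le_one _

lemma sum_chi (x : Torus d n) :
    ∑ ξ : Torus d n, chi ξ x = if x = 0 then (n : ℝ) ^ d else 0 := by
  classical
  have h : ∑ ξ : Torus d n, (ZMod.stdAddChar (∑ i, ξ i * x i) : ℂ) =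
      if x = 0 then (n : ℂ) ^ d else 0 := by
    have hprod : ∀ ξ : Torus d n, (ZMod.stdAddChar (∑ i, ξ i * x i) : ℂ) =
        ∏ i, ZMod.stdAddChar (ξ i * x i) := fun ξ =>
      map_prod (ZMod.stdAddChar (N := n)).toMonoidHom
        (fun i => Multiplicative.ofAdd (ξ i * x i)) Finset.univ
    simp only [hprod]
    rw [← Fintype.prod_sum (fun i k => (ZMod.stdAddChar (k * x i) : ℂ))]
    simp only [AddChar.sum_mulShift _ (ZMod.isPrimitive_stdAddChar n)]
    split_ifs with hx
    · simp [hx, ZMod.card]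
    · obtain ⟨i, hi⟩ := Function.ne_iff.1 hx
      exact Finset.prod_eq_zero (Finset.mem_univ i) (by rw [if_neg (by simpa using hi), Nat.cast_zero])
  have := congrArg Complex.re h
  simp only [Complex.re_sum] at this
  simp only [chi]
  rw [this]
  split_ifs
  · norm_cast
  · simp

lemma lap_chi (hd : 1 ≤ d) (ξ x : Torus d n) : lap (chi ξ) x = -symb ξ * chi ξ x := by
  have hd' : (d : ℝ) ≠ 0 := by positivity
  have h1 : ∀ i, ∑ j, ξ j * (x + (Pi.single i 1 : Torus d n)) j = ∑ j, ξ j * x j + ξ i := by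
    intro i
    simp [mul_add, Finset.sum_add_distrib, Pi.single_apply]
  have h2 : ∀ i, ∑ j, ξ j * (x + -(Pi.single i 1 : Torus d n)) j = ∑ j, ξ j * x j - ξ i := by
    intro i
    simp [mul_add, Finset.sum_add_distrib, Pi.single_apply, sub_eq_add_neg]
  have h3 : ∀ i, (chi ξ (x + unitStep (i, true)) - chi ξ x) +
      (chi ξ (x + unitStep (i, false)) - chi ξ x)
      = -2 * ((1 - (ZMod.stdAddChar (ξ i) : ℂ).re) * chi ξ x) := by
    intro i
    have := re_stdAddChar_add_add_sub (∑ j, ξ j * x j) (ξ i)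
    simp only [chi, unitStep, if_true, Bool.false_eq_true, if_false, h1, h2]
    linarith
  simp only [lap, symb, Fintype.sum_prod_type, Fintype.sum_bool, h3, ← Finset.mul_sum,
    ← Finset.sum_mul]
  field_simp

/-- With t = |m|/n ≤ 1/2, 1 - cos 2πt = 2 sin² πt, and Jordan's inequality gives sin πt ≥ 2t. -/
lemma one_sub_re_stdAddChar_ge (k : ZMod n) :
    8 * ((k.valMinAbs.natAbs : ℝ) / n) ^ 2 ≤ 1 - (ZMod.stdAddChar k : ℂ).re := by
  have hn : (0 : ℝ) < n := by exact_mod_cast NeZero.pos n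
  set m : ℤ := k.valMinAbs
  have hk : (ZMod.stdAddChar k : ℂ).re = Real.cos (2 * Real.pi * |(m : ℝ)| / n) := by
    rw [← ZMod.coe_valMinAbs k, re_stdAddChar_intCast]
    rcases abs_choice (m : ℝ) with h | h <;> rw [h]
    rw [← Real.cos_neg]; congr 1; ring
  have hm : ((m.natAbs : ℕ) : ℝ) = |(m : ℝ)| := by
    rw [← Int.cast_abs, Int.abs_eq_natAbs]; simp
  have hb : |(m : ℝ)| / n ≤ 1 / 2 := by
    rw [← hm, div_le_div_iff₀ hn two_pos]
    have := ZMod.natAbs_valMinAbs_le k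
    have h2 : k.valMinAbs.natAbs * 2 ≤ 1 * n := by omega
    exact_mod_cast h2
  rw [hk, hm]
  set t := |(m : ℝ)| / n
  have ht : 0 ≤ t := by positivity
  have h2 : 2 * Real.pi * |(m : ℝ)| / n = 2 * (Real.pi * t) := by simp only [t]; ring
  rw [h2, Real.cos_two_mul, Real.cos_sq']
  have h3 : 2 / Real.pi * (Real.pi * t) ≤ Real.sin (Real.pi * t) :=
    Real.mul_le_sin (by positivity) (by nlinarith [Real.pi_pos])
  have h4 : 2 / Real.pi * (Real.pi * t) = 2 * t := by field_simp
  rw [h4] at h3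
  nlinarith

omit [NeZero n] in
lemma exists_rad_eq (hd : 1 ≤ d) (x : Torus d n) : ∃ i, rad x = (x i).valMinAbs.natAbs := by
  have : Nonempty (Fin d) := ⟨⟨0, hd⟩⟩
  obtain ⟨i, -, hi⟩ := Finset.exists_mem_eq_sup Finset.univ Finset.univ_nonempty
    fun i => (x i).valMinAbs.natAbs
  exact ⟨i, hi⟩

omit [NeZero n] in
lemma natAbs_le_rad (x : Torus d n) (i : Fin d) : (x i).valMinAbs.natAbs ≤ rad x :=
  Finset.le_sup (f := fun i => (x i).valMinAbs.natAbs) (Finset.mem_univ i)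

omit [NeZero n] in
lemma rad_eq_zero {x : Torus d n} : rad x = 0 ↔ x = 0 := by
  constructor
  · intro h
    ext i
    have := natAbs_le_rad x i
    simpa [h] using this
  · rintro rfl
    simp [rad]

omit [NeZero n] in
lemma rad_pos {x : Torus d n} (h : x ≠ 0) : 0 < rad x :=
  Nat.pos_of_ne_zero fun h' => h (rad_eq_zero.1 h')

lemma rad_le (x : Torus d n) : rad x ≤ n / 2 :=
  Finset.sup_le fun i _ => ZMod.natAbs_valMinAbs_le (x i)

omit [NeZero n] in
lemma rad_add_le (x y : Torus d n) : rad (x + y) ≤ rad x + rad y :=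
  Finset.sup_le fun i _ => (ZMod.natAbs_valMinAbs_add_le _ _).trans
    ((Int.natAbs_add_le _ _).trans (add_le_add (natAbs_le_rad x i) (natAbs_le_rad y i)))

omit [NeZero n] in
lemma rad_neg (x : Torus d n) : rad (-x) = rad x := by simp [rad]

lemma symb_ge (hd : 1 ≤ d) (ξ : Torus d n) : 8 / d * ((rad ξ : ℝ) / n) ^ 2 ≤ symb ξ := by
  obtain ⟨i, hi⟩ := exists_rad_eq hd ξ
  have h := one_sub_re_stdAddChar_ge (ξ i)
  have h0 : ∀ j, 0 ≤ 1 - (ZMod.stdAddChar (ξ j) : ℂ).re := fun j =>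
    le_trans (by positivity) (one_sub_re_stdAddChar_ge (ξ j))
  have h1 := Finset.single_le_sum (fun j _ => h0 j) (Finset.mem_univ i)
  rw [hi, symb, div_mul_eq_mul_div, div_eq_mul_one_div, mul_comm]
  have : (0 : ℝ) < d := by exact_mod_cast hd
  gcongr
  exact h.trans h1

lemma symb_nonneg (hd : 1 ≤ d) (ξ : Torus d n) : 0 ≤ symb ξ :=
  le_trans (by positivity) (symb_ge hd ξ)

lemma symb_pos (hd : 1 ≤ d) {ξ : Torus d n} (h : ξ ≠ 0) : 0 < symb ξ := by
  have hr : (0 : ℝ) < rad ξ := by exact_mod_cast rad_pos h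
  have hn : (0 : ℝ) < n := by exact_mod_cast NeZero.pos n
  have : (0 : ℝ) < d := by exact_mod_cast hd
  exact lt_of_lt_of_le (by positivity) (symb_ge hd ξ)

/-- The kernel of `(-Δ_g)^{-p}` on functions of mean zero. -/
noncomputable def kern (d n p : ℕ) [NeZero n] (x : Torus d n) : ℝ :=
  1 / (n : ℝ) ^ d * ∑ ξ ∈ Finset.univ.erase (0 : Torus d n), (symb ξ ^ p)⁻¹ * chi ξ x

lemma lap_kern_succ (hd : 1 ≤ d) (p : ℕ) (x : Torus d n) :
    lap (kern d n (p + 1)) x = -kern d n p x := by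
  have : kern d n (p + 1) = fun y => 1 / (n : ℝ) ^ d *
      ∑ ξ ∈ Finset.univ.erase (0 : Torus d n), (symb ξ ^ (p + 1))⁻¹ * chi ξ y := rfl
  rw [this, lap_const_mul, lap_sum, kern, ← mul_neg, ← Finset.sum_neg_distrib]
  congr 1
  refine Finset.sum_congr rfl fun ξ hξ => ?_
  have := (symb_pos hd (Finset.ne_of_mem_erase hξ)).ne'
  rw [lap_const_mul, lap_chi hd]
  field_simp
  ring

lemma kern_zero (x : Torus d n) :
    kern d n 0 x = (if x = 0 then 1 else 0) - 1 / (n : ℝ) ^ d := by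
  have hn : (n : ℝ) ≠ 0 := by exact_mod_cast NeZero.ne n
  simp only [kern, pow_zero, inv_one, one_mul]
  have h := Finset.sum_erase_add Finset.univ (fun ξ => chi ξ x) (Finset.mem_univ (0 : Torus d n))
  rw [sum_chi, chi_zero_left] at h
  rw [eq_sub_of_add_eq h]
  split_ifs
  · field_simp
  · field_simp
    ring

lemma kern_neg (p : ℕ) (x : Torus d n) : kern d n p (-x) = kern d n p x := by
  simp [kern, chi_neg]

lemma kern_le_kern_zero (hd : 1 ≤ d) (p : ℕ) (x : Torus d n) :
    kern d n p x ≤ kern d n p 0 := by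
  unfold kern
  gcongr with ξ hξ
  · have := symb_nonneg hd ξ
    positivity
  · rw [chi_zero_right]; exact chi_le_one ξ x

end Fourier

/-! ### Estimates of the kernel of (-Δ)^{-2} by dyadic frequency shells. -/

section Bounds

variable {d n : ℕ} [NeZero n]

lemma card_rad_le (R : ℕ) :
    (Finset.univ.filter fun ξ : Torus d n => rad ξ ≤ R).card ≤ (2 * R + 1) ^ d := by
  have h : (Finset.univ.filter fun ξ : Torus d n => rad ξ ≤ R).card ≤
      (Fintype.piFinset fun _ : Fin d => Finset.Icc (-(R : ℤ)) R).card := by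
    refine Finset.card_le_card_of_injOn (fun ξ i => (ξ i).valMinAbs) (fun ξ hξ => ?_) ?_
    · simp only [Finset.coe_filter, Finset.mem_univ, true_and, Set.mem_ofPred_eq] at hξ
      simp only [Finset.mem_coe, Fintype.mem_piFinset, Finset.mem_Icc]
      intro i
      have := (natAbs_le_rad ξ i).trans hξ
      omega
    · intro ξ _ ζ _ h
      ext i
      exact ZMod.injective_valMinAbs (congrFun h i)
  refine h.trans (le_of_eq ?_)
  simp only [Fintype.card_piFinset, Int.card_Icc, Finset.prod_const, Finset.card_univ,
    Fintype.card_fin]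
  congr 1
  omega

/-- The shell 2^j ≤ rad < 2^(j+1) lies in a box with fewer than 4 · 2^j points per side. -/
lemma sum_le_sum_shells (F : Torus d n → ℝ) (A : ℕ → ℝ) (hA : ∀ j, 0 ≤ A j)
    (hF : ∀ ξ j, 2 ^ j ≤ rad ξ → rad ξ < 2 ^ (j + 1) → F ξ ≤ A j) :
    ∑ ξ ∈ Finset.univ.erase (0 : Torus d n), F ξ ≤
      4 ^ d * ∑ j ∈ Finset.range (Nat.log 2 n + 1), 2 ^ (j * d) * A j := by
  have hmap : ∀ ξ ∈ Finset.univ.erase (0 : Torus d n),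
      Nat.log 2 (rad ξ) ∈ Finset.range (Nat.log 2 n + 1) := by
    intro ξ _
    rw [Finset.mem_range, Nat.lt_succ_iff]
    exact Nat.log_mono_right ((rad_le ξ).trans (Nat.div_le_self n 2))
  rw [← Finset.sum_fiberwise_of_maps_to hmap, Finset.mul_sum]
  refine Finset.sum_le_sum fun j _ => ?_
  have hb : ∀ ξ ∈ (Finset.univ.erase (0 : Torus d n)).filter (fun ξ => Nat.log 2 (rad ξ) = j),
      2 ^ j ≤ rad ξ ∧ rad ξ < 2 ^ (j + 1) := by
    intro ξ hξ
    simp only [Finset.mem_filter, Finset.mem_erase, Finset.mem_univ, and_true] at hξ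
    exact (Nat.log_eq_iff (Or.inr ⟨one_lt_two, (rad_pos hξ.1).ne'⟩)).1 hξ.2
  calc _ ≤ ∑ ξ ∈ (Finset.univ.erase (0 : Torus d n)).filter (fun ξ => Nat.log 2 (rad ξ) = j),
        A j := Finset.sum_le_sum fun ξ hξ => hF ξ j (hb ξ hξ).1 (hb ξ hξ).2
    _ = _ * A j := by rw [Finset.sum_const, nsmul_eq_mul]
    _ ≤ (4 ^ d * 2 ^ (j * d)) * A j := ?_
    _ = _ := by ring
  gcongr
  · exact hA j
  have h1 : ((Finset.univ.erase (0 : Torus d n)).filter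
      (fun ξ => Nat.log 2 (rad ξ) = j)).card ≤ (2 * (2 ^ (j + 1) - 1) + 1) ^ d := by
    refine (Finset.card_le_card fun ξ hξ => ?_).trans (card_rad_le (2 ^ (j + 1) - 1))
    have := (hb ξ hξ).2
    simp only [Finset.mem_filter, Finset.mem_univ, true_and]
    omega
  have h2 : (2 * (2 ^ (j + 1) - 1) + 1) ^ d ≤ 4 ^ d * 2 ^ (j * d) := by
    rw [pow_mul, ← mul_pow]
    refine Nat.pow_le_pow_left ?_ d
    have : 1 ≤ 2 ^ j := Nat.one_le_two_pow
    rw [pow_succ]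
    omega
  exact_mod_cast h1.trans h2

lemma inv_symb_sq_le (hd : 1 ≤ d) {ξ : Torus d n} (h : ξ ≠ 0) :
    (symb ξ ^ 2)⁻¹ ≤ (d : ℝ) ^ 2 * n ^ 4 * ((rad ξ : ℝ) ^ 4)⁻¹ := by
  have hr : (0 : ℝ) < rad ξ := by exact_mod_cast rad_pos h
  have hn : (0 : ℝ) < n := by exact_mod_cast NeZero.pos n
  have hd' : (0 : ℝ) < d := by exact_mod_cast hd
  have h1 : 1 / d * ((rad ξ : ℝ) / n) ^ 2 ≤ symb ξ := by
    refine le_trans ?_ (symb_ge hd ξ)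
    gcongr
    norm_num
  calc (symb ξ ^ 2)⁻¹ ≤ ((1 / d * ((rad ξ : ℝ) / n) ^ 2) ^ 2)⁻¹ := by gcongr
    _ = _ := by field_simp

omit [NeZero n] in
lemma inv_rad_le {j : ℕ} {ξ : Torus d n} (h : 2 ^ j ≤ rad ξ) :
    ((rad ξ : ℝ) ^ 4)⁻¹ ≤ ((2 : ℝ) ^ (j * 4))⁻¹ := by
  rw [pow_mul]
  have : (2 : ℝ) ^ j ≤ rad ξ := by exact_mod_cast h
  gcongr

/-- Shell j contributes 2^{j(d-4)}: all shells count equally for d = 4, which produces the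
logarithm, and the highest frequencies dominate for d ≥ 5. -/
lemma sum_inv_symb_sq_le (hd : 1 ≤ d) :
    ∑ ξ ∈ Finset.univ.erase (0 : Torus d n), (symb ξ ^ 2)⁻¹ ≤ (d : ℝ) ^ 2 * n ^ 4 *
      (4 ^ d * ∑ j ∈ Finset.range (Nat.log 2 n + 1), 2 ^ (j * d) * ((2 : ℝ) ^ (j * 4))⁻¹) := by
  calc _ ≤ ∑ ξ ∈ Finset.univ.erase (0 : Torus d n),
        (d : ℝ) ^ 2 * n ^ 4 * ((rad ξ : ℝ) ^ 4)⁻¹ :=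
        Finset.sum_le_sum fun ξ hξ => inv_symb_sq_le hd (Finset.ne_of_mem_erase hξ)
    _ = (d : ℝ) ^ 2 * n ^ 4 * ∑ ξ ∈ Finset.univ.erase (0 : Torus d n), ((rad ξ : ℝ) ^ 4)⁻¹ := by
        rw [Finset.mul_sum]
    _ ≤ _ := by
        gcongr
        exact sum_le_sum_shells _ _ (fun j => by positivity) fun ξ j h _ => inv_rad_le h

lemma natLog_add_one_le {n : ℕ} (hn : 2 ≤ n) : ((Nat.log 2 n + 1 : ℕ) : ℝ) ≤ 4 * Real.log n := by
  have h2 := Real.log_two_gt_d9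
  have hl : Real.log 2 ≤ Real.log n := Real.log_le_log (by norm_num) (by exact_mod_cast hn)
  have h1 : (Nat.log 2 n : ℝ) * Real.log 2 ≤ Real.log n := by
    rw [← Real.log_pow]
    refine Real.log_le_log (by positivity) ?_
    exact_mod_cast Nat.pow_log_le_self 2 (by omega)
  have h3 : (Nat.log 2 n : ℝ) * (1 / 2) ≤ (Nat.log 2 n : ℝ) * Real.log 2 := by
    gcongr; linarith
  push_cast
  linarith

lemma sum_inv_symb_sq_le_four (hn : 2 ≤ n) :
    ∑ ξ ∈ Finset.univ.erase (0 : Torus 4 n), (symb ξ ^ 2)⁻¹ ≤ 16384 * (n : ℝ) ^ 4 * Real.log n := by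
  refine (sum_inv_symb_sq_le (by norm_num)).trans ?_
  have h1 : ∀ j : ℕ, (2 : ℝ) ^ (j * 4) * ((2 : ℝ) ^ (j * 4))⁻¹ = 1 := fun j =>
    mul_inv_cancel₀ (by positivity)
  simp only [h1, Finset.sum_const, Finset.card_range, nsmul_eq_mul, mul_one]
  have h2 := natLog_add_one_le hn
  calc _ ≤ ((4 : ℕ) : ℝ) ^ 2 * (n : ℝ) ^ 4 * (4 ^ 4 * (4 * Real.log n)) := by gcongr
    _ = _ := by push_cast; ring

lemma kern_two_zero_eq : kern d n 2 0 =
    1 / (n : ℝ) ^ d * ∑ ξ ∈ Finset.univ.erase (0 : Torus d n), (symb ξ ^ 2)⁻¹ := by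
  simp [kern, chi_zero_right]

lemma kern_two_zero_le_four (hn : 2 ≤ n) : kern 4 n 2 0 ≤ 16384 * Real.log n := by
  have hn' : (0 : ℝ) < n := by exact_mod_cast NeZero.pos n
  rw [kern_two_zero_eq]
  calc _ ≤ 1 / (n : ℝ) ^ 4 * (16384 * (n : ℝ) ^ 4 * Real.log n) := by
        gcongr; exact sum_inv_symb_sq_le_four hn
    _ = _ := by field_simp

lemma kern_two_zero_le_of_five_le (hd : 5 ≤ d) :
    kern d n 2 0 ≤ (d : ℝ) ^ 2 * 4 ^ d * 2 := by
  have hn' : (0 : ℝ) < n := by exact_mod_cast NeZero.pos n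
  obtain ⟨k, rfl⟩ : ∃ k, d = k + 4 := ⟨d - 4, by omega⟩
  rw [kern_two_zero_eq]
  have h1 : ∀ j : ℕ, (2 : ℝ) ^ (j * (k + 4)) * ((2 : ℝ) ^ (j * 4))⁻¹ = (2 ^ k) ^ j := by
    intro j
    rw [mul_add, pow_add, mul_assoc, mul_inv_cancel₀ (by positivity), mul_one, mul_comm, pow_mul]
  have h2 : (2 : ℝ) ≤ 2 ^ k := by
    calc (2 : ℝ) = 2 ^ 1 := by norm_num
      _ ≤ 2 ^ k := pow_le_pow_right₀ (by norm_num) (by omega)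
  have h3 : ∑ j ∈ Finset.range (Nat.log 2 n + 1), ((2 : ℝ) ^ k) ^ j ≤ 2 * (n : ℝ) ^ k := by
    have hg : ∀ J : ℕ, ∑ j ∈ Finset.range (J + 1), ((2 : ℝ) ^ k) ^ j ≤ 2 * (2 ^ k) ^ J := by
      intro J
      induction J with
      | zero => simp
      | succ J ih =>
        rw [Finset.sum_range_succ]
        have : 2 * ((2 : ℝ) ^ k) ^ J ≤ (2 ^ k) ^ (J + 1) := by
          rw [pow_succ', ]; gcongr
        linarith
    refine (hg _).trans ?_
    rw [← pow_mul, mul_comm k, pow_mul]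
    gcongr
    exact_mod_cast Nat.pow_log_le_self 2 (NeZero.ne n)
  calc _ ≤ 1 / (n : ℝ) ^ (k + 4) * (((k + 4 : ℕ) : ℝ) ^ 2 * n ^ 4 * (4 ^ (k + 4) *
        (2 * (n : ℝ) ^ k))) := by
        gcongr
        refine (sum_inv_symb_sq_le (by omega)).trans ?_
        simp only [h1]
        gcongr
    _ = _ := by
        rw [pow_add]; field_simp

/-- The exponent 1/2 is chosen so that, for d ≤ 3, the shells of ∑ |ξ|^{-4} |ξ|^{1/2} decay
geometrically; exponent 1 would already give a logarithm for d = 3. -/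
lemma one_sub_cos_le_sqrt (θ : ℝ) : 1 - Real.cos θ ≤ 2 * √|θ| := by
  rcases le_total 1 |θ| with h | h
  · have h1 : 1 ≤ √|θ| := Real.one_le_sqrt.2 h
    linarith [Real.neg_one_le_cos θ]
  · have h1 := Real.one_sub_sq_div_two_le_cos (x := θ)
    have h2 : |θ| ≤ √|θ| := Real.le_sqrt_of_sq_le (by nlinarith [abs_nonneg θ])
    have h3 : θ ^ 2 ≤ |θ| := by
      rw [← sq_abs]; nlinarith [abs_nonneg θ]
    nlinarith [abs_nonneg θ]

lemma one_sub_chi_le (ξ x : Torus d n) (k : Fin d → ℤ) (m : ℝ) (hx : ∀ i, x i = k i)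
    (hk : ∀ i, |(k i : ℝ)| ≤ m) :
    1 - chi ξ x ≤ 2 * (√(2 * Real.pi * d * m / n) * √(rad ξ)) := by
  have hn : (0 : ℝ) < n := by exact_mod_cast NeZero.pos n
  have h1 : ∑ i, ξ i * x i = ((∑ i, (ξ i).valMinAbs * k i : ℤ) : ZMod n) := by
    push_cast
    exact Finset.sum_congr rfl fun i _ => by rw [hx]
  rw [chi, h1, re_stdAddChar_intCast]
  refine (one_sub_cos_le_sqrt _).trans ?_
  rw [← Real.sqrt_mul' _ (Nat.cast_nonneg _)]
  gcongr
  rw [abs_div, abs_mul, abs_mul, abs_of_pos Real.pi_pos, abs_two, abs_of_pos hn,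
    div_mul_eq_mul_div, mul_assoc (2 * Real.pi), mul_assoc (2 * Real.pi)]
  gcongr
  push_cast
  calc _ ≤ ∑ i, |((ξ i).valMinAbs : ℝ) * k i| := Finset.abs_sum_le_sum_abs _ _
    _ ≤ ∑ _i : Fin d, (rad ξ : ℝ) * m := by
        refine Finset.sum_le_sum fun i _ => ?_
        rw [abs_mul]
        have := natAbs_le_rad ξ i
        have h3 : |((ξ i).valMinAbs : ℝ)| ≤ rad ξ := by
          rw [← Int.cast_abs, Int.abs_eq_natAbs]
          exact_mod_cast this
        gcongr
        exact hk i
    _ = _ := by simp; ring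

lemma kern_two_zero_sub_le (hd : 1 ≤ d) (hd3 : d ≤ 3) (x : Torus d n) (k : Fin d → ℤ) (m : ℝ)
    (hx : ∀ i, x i = k i) (hk : ∀ i, |(k i : ℝ)| ≤ m) :
    kern d n 2 0 - kern d n 2 x ≤ 200000 * (1 / (n : ℝ) ^ d * n ^ 4) * √(m / n) := by
  have hn : (0 : ℝ) < n := by exact_mod_cast NeZero.pos n
  have hd3' : (d : ℝ) ≤ 3 := by exact_mod_cast hd3
  have hm : 0 ≤ m := (abs_nonneg _).trans (hk ⟨0, hd⟩)
  -- 2πd ≤ 6π < 25.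
  have hs : √(2 * Real.pi * d * m / n) ≤ 5 * √(m / n) := by
    rw [show (5 : ℝ) = √25 by rw [show (25 : ℝ) = 5 ^ 2 by norm_num]; simp,
      ← Real.sqrt_mul (by norm_num), ← mul_div_assoc]
    gcongr
    nlinarith [Real.pi_lt_d2, Real.pi_pos]
  have h1 : kern d n 2 0 - kern d n 2 x = 1 / (n : ℝ) ^ d *
      ∑ ξ ∈ Finset.univ.erase (0 : Torus d n), (symb ξ ^ 2)⁻¹ * (1 - chi ξ x) := by
    simp only [kern, chi_zero_right, mul_sub, Finset.sum_sub_distrib]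
  have h2 : ∑ ξ ∈ Finset.univ.erase (0 : Torus d n), (symb ξ ^ 2)⁻¹ * (1 - chi ξ x) ≤
      90 * n ^ 4 * √(m / n) *
        ∑ ξ ∈ Finset.univ.erase (0 : Torus d n), ((rad ξ : ℝ) ^ 4)⁻¹ * √(rad ξ) := by
    rw [Finset.mul_sum]
    refine Finset.sum_le_sum fun ξ hξ => ?_
    calc _ ≤ ((d : ℝ) ^ 2 * n ^ 4 * ((rad ξ : ℝ) ^ 4)⁻¹) *
          (2 * (√(2 * Real.pi * d * m / n) * √(rad ξ))) := by
          have := chi_le_one ξ x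
          exact mul_le_mul (inv_symb_sq_le hd (Finset.ne_of_mem_erase hξ))
            (one_sub_chi_le ξ x k m hx hk) (by linarith) (by positivity)
      _ ≤ (3 ^ 2 * n ^ 4 * ((rad ξ : ℝ) ^ 4)⁻¹) * (2 * ((5 * √(m / n)) * √(rad ξ))) := by gcongr
      _ = _ := by ring
  have hq : √2 < 1.4143 := by
    rw [Real.sqrt_lt' (by norm_num)]; norm_num
  have hq0 : 0 ≤ √2 := Real.sqrt_nonneg 2
  have h3 : ∑ ξ ∈ Finset.univ.erase (0 : Torus d n), ((rad ξ : ℝ) ^ 4)⁻¹ * √(rad ξ) ≤ 4 ^ d * 5 := by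
    refine (sum_le_sum_shells _ (fun j => ((2 : ℝ) ^ (j * 4))⁻¹ * √2 ^ (j + 1))
      (fun j => by positivity) fun ξ j h h' => ?_).trans ?_
    · have h4 : √(rad ξ) ≤ √2 ^ (j + 1) := by
        rw [Real.sqrt_le_left (by positivity), ← pow_mul, mul_comm, pow_mul,
          Real.sq_sqrt (by norm_num)]
        exact_mod_cast h'.le
      exact mul_le_mul (inv_rad_le h) h4 (Real.sqrt_nonneg _) (by positivity)
    · gcongr
      calc _ ≤ ∑ j ∈ Finset.range (Nat.log 2 n + 1), √2 * (√2 / 2) ^ j := by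
            refine Finset.sum_le_sum fun j _ => ?_
            have h5 : (2 : ℝ) ^ (j * d) ≤ 2 ^ (j * 3) :=
              pow_le_pow_right₀ (by norm_num) (Nat.mul_le_mul_left j hd3)
            calc _ ≤ (2 : ℝ) ^ (j * 3) * (((2 : ℝ) ^ (j * 4))⁻¹ * √2 ^ (j + 1)) := by gcongr
              _ = _ := by
                rw [show j * 4 = j * 3 + j by ring, pow_add (2 : ℝ), div_pow, pow_succ]
                field_simp
        _ = √2 * ∑ j ∈ Finset.range (Nat.log 2 n + 1), (√2 / 2) ^ j := by rw [Finset.mul_sum]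
        _ ≤ √2 * (1 - √2 / 2)⁻¹ := by
            have hlt : √2 / 2 < 1 := by linarith
            have h0 : 0 ≤ √2 / 2 := by positivity
            gcongr
            rw [← tsum_geometric_of_lt_one h0 hlt]
            exact (summable_geometric_of_lt_one h0 hlt).sum_le_tsum _ fun j _ => by positivity
        _ ≤ 5 := by
            rw [← div_eq_mul_inv, div_le_iff₀ (by linarith)]
            linarith
  have h4 : (4 : ℝ) ^ d ≤ 4 ^ 3 := pow_le_pow_right₀ (by norm_num) hd3
  rw [h1]
  calc _ ≤ 1 / (n : ℝ) ^ d * (90 * n ^ 4 * √(m / n) * (4 ^ d * 5)) := by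
        gcongr
        refine h2.trans ?_
        gcongr
    _ ≤ 1 / (n : ℝ) ^ d * (90 * n ^ 4 * √(m / n) * (4 ^ 3 * 5)) := by gcongr
    _ = 28800 * (1 / (n : ℝ) ^ d * n ^ 4) * √(m / n) := by ring
    _ ≤ _ := by gcongr; norm_num

end Bounds

/-! ### Expected maxima of Gaussian families. -/

section Gaussian

variable {Ω : Type*} [MeasurableSpace Ω] {P : Measure Ω}
variable {ι : Type*}

lemma integrable_iSup [Finite ι] [Nonempty ι] {X : ι → Ω → ℝ}
    (h : ∀ i, Integrable (X i) P) : Integrable (fun ω => ⨆ i, X i ω) P := by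
  have := Fintype.ofFinite ι
  refine Integrable.mono' (g := fun ω => ∑ i, |X i ω|)
    (integrable_finsetSum _ fun i _ => (h i).abs)
    (AEMeasurable.iSup fun i => (h i).aemeasurable).aestronglyMeasurable
    (Filter.Eventually.of_forall fun ω => ?_)
  obtain ⟨i, hi⟩ := exists_eq_ciSup_of_finite (f := fun i => X i ω)
  rw [← hi]
  exact Finset.single_le_sum (f := fun i => |X i ω|) (fun _ _ => abs_nonneg _) (Finset.mem_univ i)

/-- A centred real Gaussian random variable. -/
structure IsCentredGaussian (X : Ω → ℝ) (P : Measure Ω) : Prop where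
  law : HasGaussianLaw X P
  mean : ∫ ω, X ω ∂P = 0

lemma IsCentredGaussian.map_eq {X : Ω → ℝ} (h : IsCentredGaussian X P) :
    P.map X = gaussianReal 0 (∫ ω, X ω ^ 2 ∂P).toNNReal := by
  have h1 := h.law.map_eq_gaussianReal
  rw [h.mean, variance_of_integral_eq_zero h.law.aemeasurable h.mean] at h1
  simpa using h1

lemma IsCentredGaussian.integrable_exp {X : Ω → ℝ} (h : IsCentredGaussian X P) (t : ℝ) :
    Integrable (fun ω => Real.exp (t * X ω)) P := by
  have h1 := integrable_exp_mul_gaussianReal (μ := 0) (v := (∫ ω, X ω ^ 2 ∂P).toNNReal) t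
  rw [← h.map_eq, integrable_map_measure (by fun_prop) h.law.aemeasurable] at h1
  exact h1

lemma IsCentredGaussian.integral_exp {X : Ω → ℝ} (h : IsCentredGaussian X P) (t : ℝ) :
    ∫ ω, Real.exp (t * X ω) ∂P = Real.exp ((∫ ω, X ω ^ 2 ∂P) * t ^ 2 / 2) := by
  have h1 := mgf_gaussianReal h.map_eq t
  rw [mgf] at h1
  rw [h1, Real.coe_toNNReal _ (integral_nonneg fun ω => sq_nonneg _)]
  simp

/-- The exponential-moment bound t E max ≤ L + v t²/2, optimised at t = √(2L/v). No independence is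
needed. -/
lemma integral_iSup_le [Fintype ι] [Nonempty ι] [IsProbabilityMeasure P] {X : ι → Ω → ℝ}
    {v L : ℝ} (hX : ∀ i, IsCentredGaussian (X i) P) (hv : 0 < v) (hL : 0 < L)
    (hvar : ∀ i, ∫ ω, X i ω ^ 2 ∂P ≤ v) (hcard : Real.log (Fintype.card ι) ≤ L) :
    ∫ ω, ⨆ i, X i ω ∂P ≤ √(2 * v * L) := by
  have hint : Integrable (fun ω => ⨆ i, X i ω) P := integrable_iSup fun i => (hX i).law.integrable
  have key : ∀ t : ℝ, 0 < t → t * ∫ ω, ⨆ i, X i ω ∂P ≤ L + v * t ^ 2 / 2 := by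
    intro t ht
    -- The tangent inequality y ≤ e^{y-a} + a - 1 replaces Jensen; with this `a` the expectation of
    -- e^{-a} ∑ e^{tX_i} is at most 1.
    set a := L + v * t ^ 2 / 2
    have h1 : ∀ ω, t * (⨆ i, X i ω) ≤ Real.exp (-a) * ∑ i, Real.exp (t * X i ω) + (a - 1) := by
      intro ω
      obtain ⟨i, hi⟩ := exists_eq_ciSup_of_finite (f := fun i => X i ω)
      rw [← hi]
      have h2 := Real.add_one_le_exp (t * X i ω - a)
      have h3 : Real.exp (t * X i ω - a) = Real.exp (-a) * Real.exp (t * X i ω) := by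
        rw [← Real.exp_add]; ring_nf
      have h4 : Real.exp (t * X i ω) ≤ ∑ i, Real.exp (t * X i ω) :=
        Finset.single_le_sum (f := fun i => Real.exp (t * X i ω))
          (fun _ _ => (Real.exp_pos _).le) (Finset.mem_univ i)
      have h5 := mul_le_mul_of_nonneg_left h4 (Real.exp_pos (-a)).le
      linarith
    have hsum : Integrable (fun ω => ∑ i, Real.exp (t * X i ω)) P :=
      integrable_finsetSum _ fun i _ => (hX i).integrable_exp t
    have h2 : ∫ ω, t * (⨆ i, X i ω) ∂P ≤
        ∫ ω, (Real.exp (-a) * ∑ i, Real.exp (t * X i ω) + (a - 1)) ∂P :=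
      integral_mono (hint.const_mul t)
        ((hsum.const_mul (Real.exp (-a))).add (integrable_const (a - 1))) h1
    rw [integral_const_mul, integral_add (hsum.const_mul _) (integrable_const _),
      integral_const_mul, integral_finsetSum _ fun i _ => (hX i).integrable_exp t] at h2
    simp only [(hX _).integral_exp, integral_const, probReal_univ, smul_eq_mul, one_mul] at h2
    refine h2.trans ?_
    have h3 : ∑ i, Real.exp ((∫ ω, X i ω ^ 2 ∂P) * t ^ 2 / 2) ≤
        Fintype.card ι * Real.exp (v * t ^ 2 / 2) := by
      rw [← nsmul_eq_mul, ← Finset.card_univ, ← Finset.sum_const]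
      gcongr with i
      exact hvar i
    have h4 : (Fintype.card ι : ℝ) ≤ Real.exp L := by
      rwa [← Real.log_le_iff_le_exp (by exact_mod_cast Fintype.card_pos)]
    have h5 : Real.exp (-a) * ∑ i, Real.exp ((∫ ω, X i ω ^ 2 ∂P) * t ^ 2 / 2) ≤ 1 := by
      calc _ ≤ Real.exp (-a) * (Real.exp L * Real.exp (v * t ^ 2 / 2)) := by
            gcongr; exact h3.trans (by gcongr)
        _ = 1 := by
          rw [← Real.exp_add, ← Real.exp_add, show -a + (L + v * t ^ 2 / 2) = 0 by simp [a],
            Real.exp_zero]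
    linarith
  have hs : 0 < √(2 * L / v) := Real.sqrt_pos.2 (by positivity)
  have h1 := key _ hs
  rw [Real.sq_sqrt (by positivity)] at h1
  have h2 : √(2 * L / v) * √(2 * v * L) = 2 * L := by
    rw [← Real.sqrt_mul (by positivity), show 2 * L / v * (2 * v * L) = (2 * L) ^ 2 by
      field_simp]
    exact Real.sqrt_sq (by positivity)
  have h3 : L + v * (2 * L / v) / 2 = 2 * L := by field_simp; ring
  rw [h3] at h1
  exact le_of_mul_le_mul_left (h1.trans h2.ge) hs

/-- The first absolute moment of the standard Gaussian. -/
noncomputable def absMoment : ℝ := ∫ x, |x| ∂(gaussianReal 0 1)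

lemma absMoment_pos : 0 < absMoment := by
  rw [absMoment, integral_pos_iff_support_of_nonneg (fun x => abs_nonneg x)]
  · have := nullSingletonClass_gaussianReal (μ := 0) (v := 1) one_ne_zero
    have h : Function.support (fun x : ℝ => |x|) = {0}ᶜ := by ext; simp
    rw [h, prob_compl_eq_one_sub (measurableSet_singleton 0), measure_singleton]
    simp
  · exact ((memLp_id_gaussianReal 1).integrable le_rfl).abs

lemma IsCentredGaussian.integral_abs {X : Ω → ℝ} (h : IsCentredGaussian X P) :
    ∫ ω, |X ω| ∂P = √(∫ ω, X ω ^ 2 ∂P) * absMoment := by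
  have hv : 0 ≤ ∫ ω, X ω ^ 2 ∂P := integral_nonneg fun ω => sq_nonneg _
  rw [← integral_map (f := fun x : ℝ => |x|) h.law.aemeasurable (by fun_prop), h.map_eq]
  have h1 := gaussianReal_map_const_mul (μ := 0) (v := 1) √(∫ ω, X ω ^ 2 ∂P)
  have h2 : NNReal.mk (√(∫ ω, X ω ^ 2 ∂P) ^ 2) (sq_nonneg _) * 1 =
      (∫ ω, X ω ^ 2 ∂P).toNNReal := by
    ext; simp [hv]
  rw [mul_zero, h2] at h1
  rw [← h1, integral_map (by fun_prop) (by fun_prop)]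
  simp only [abs_mul, abs_of_nonneg (Real.sqrt_nonneg _), integral_const_mul, absMoment]

lemma gaussianReal_Ici_ge {t : ℝ} (ht : 0 ≤ t) :
    (√(2 * Real.pi))⁻¹ * Real.exp (-(t + 1) ^ 2 / 2) ≤ (gaussianReal 0 1).real (Set.Ici t) := by
  have h1 : (gaussianReal 0 1).real (Set.Icc t (t + 1)) ≤ (gaussianReal 0 1).real (Set.Ici t) :=
    measureReal_mono Set.Icc_subset_Ici_self
  refine le_trans ?_ h1
  rw [measureReal_def, gaussianReal_apply_eq_integral 0 one_ne_zero,
    ENNReal.toReal_ofReal (integral_nonneg fun x => gaussianPDFReal_nonneg _ _ _)]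
  have h2 : ∫ x in Set.Icc t (t + 1), ((√(2 * Real.pi))⁻¹ * Real.exp (-(t + 1) ^ 2 / 2)) ≤
      ∫ x in Set.Icc t (t + 1), gaussianPDFReal 0 1 x := by
    refine setIntegral_mono_on (integrableOn_const (by simp)) (integrable_gaussianPDFReal 0 1).integrableOn
      measurableSet_Icc fun x hx => ?_
    rw [gaussianPDFReal]
    simp only [NNReal.coe_one, mul_one, sub_zero]
    gcongr
    · exact ht.trans hx.1
    · exact hx.2
  simpa using h2

/-- For M variables, the level t = √(log M) - 1 is exceeded by some Z_i with probability at least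
1/2. Hence E max ≥ t/2 - E|Z| ≥ √(log M)/2 - 3/2, and √(log M) ≥ 6 turns this into the factor 1/4.
-/
lemma integral_iSup_indep_ge [Fintype ι] [Nonempty ι] [IsProbabilityMeasure P]
    {Z : ι → Ω → ℝ} (hind : iIndepFun Z P) (hZ : ∀ i, P.map (Z i) = gaussianReal 0 1)
    (hcard : 36 ≤ Real.log (Fintype.card ι)) :
    1 / 4 * √(Real.log (Fintype.card ι)) ≤ ∫ ω, ⨆ i, Z i ω ∂P := by
  set M : ℝ := ((Fintype.card ι : ℕ) : ℝ) with hM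
  have hmeas : ∀ i, AEMeasurable (Z i) P := fun i =>
    AEMeasurable.of_map_ne_zero (by rw [hZ]; exact IsProbabilityMeasure.ne_zero _)
  have hmem : ∀ i, MemLp (Z i) 2 P := fun i => by
    have := memLp_id_gaussianReal (μ := 0) (v := 1) 2
    rw [← hZ i, memLp_map_measure_iff (by fun_prop) (hmeas i)] at this
    exact this
  have hint : ∀ i, Integrable (Z i) P := fun i => (hmem i).integrable (by norm_num)
  have hM4 : 4 ≤ M := by
    have hpos : 0 < M := by simp [M, Fintype.card_pos]
    have := Real.log_le_sub_one_of_pos hpos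
    linarith
  obtain ⟨i₀⟩ := ‹Nonempty ι›
  have habs : ∫ ω, |Z i₀ ω| ∂P ≤ 1 := by
    have h1 : ∫ ω, Z i₀ ω ^ 2 ∂P = 1 := by
      have h2 := variance_id_gaussianReal (μ := 0) (v := 1)
      rw [← hZ i₀, variance_of_integral_eq_zero (by fun_prop) (by rw [hZ]; simp [integral_id_gaussianReal]),
        integral_map (hmeas i₀) (by fun_prop)] at h2
      simpa using h2
    calc ∫ ω, |Z i₀ ω| ∂P ≤ ∫ ω, (Z i₀ ω ^ 2 + 1) / 2 ∂P := by
          refine integral_mono (hint i₀).abs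
            (((hmem i₀).integrable_sq.add (integrable_const 1)).div_const 2) fun ω => ?_
          have := sq_nonneg (|Z i₀ ω| - 1)
          have h3 := sq_abs (Z i₀ ω)
          simp only
          linarith
      _ = 1 := by
        rw [integral_div, integral_add (hmem i₀).integrable_sq (integrable_const 1), h1]
        simp
  set t := √(Real.log M) - 1 with htdef
  have hs6 : 6 ≤ √(Real.log M) := Real.le_sqrt_of_sq_le (by linarith)
  have ht : 0 < t := by linarith
  set p := (gaussianReal 0 1).real (Set.Ici t) with hp
  -- The shift by 1 in t makes the tail bound e^{-(t+1)²/2} equal to M^{-1/2}, so p M ≥ √(M/2π).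
  have hpM : 1 ≤ p * M := by
    have h1 := gaussianReal_Ici_ge ht.le
    have h2 : t + 1 = √(Real.log M) := by simp [t]
    rw [neg_div, h2, Real.sq_sqrt (by linarith)] at h1
    have h3 : Real.exp (-(Real.log M / 2)) * √M = 1 := by
      rw [Real.sqrt_eq_rpow, Real.rpow_def_of_pos (by linarith), ← Real.exp_add]
      simp; ring
    have h5 : √M * √M = M := Real.mul_self_sqrt (by linarith)
    have h6 : √(2 * Real.pi) ≤ √M := Real.sqrt_le_sqrt (by
      have : Real.log M ≤ M - 1 := Real.log_le_sub_one_of_pos (by linarith)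
      linarith [Real.pi_le_four])
    have h7 : 0 < √(2 * Real.pi) := Real.sqrt_pos.2 (by positivity)
    calc (1 : ℝ) ≤ (√(2 * Real.pi))⁻¹ * √M := by
          rw [inv_mul_eq_div, one_le_div h7]; exact h6
      _ = (√(2 * Real.pi))⁻¹ * Real.exp (-(Real.log M / 2)) * M := by
          rw [mul_assoc]
          congr 1
          calc √M = (Real.exp (-(Real.log M / 2)) * √M) * √M := by rw [h3, one_mul]
            _ = _ := by rw [mul_assoc, h5]
      _ ≤ p * M := by gcongr
  have hlow : P.real {ω | ∀ i, Z i ω < t} ≤ 1 / 2 := by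
    have h1 := hind.measure_inter_preimage_eq_mul Finset.univ (sets := fun _ => Set.Iio t)
      fun i _ => measurableSet_Iio
    have h2 : ∀ i, P (Z i ⁻¹' Set.Iio t) = gaussianReal 0 1 (Set.Iio t) := fun i => by
      rw [← hZ i, Measure.map_apply_of_aemeasurable (hmeas i) measurableSet_Iio]
    simp only [h2, Finset.prod_const, Finset.card_univ] at h1
    have h3 : (⋂ i ∈ (Finset.univ : Finset ι), Z i ⁻¹' Set.Iio t) = {ω | ∀ i, Z i ω < t} := by
      ext; simp
    rw [h3] at h1
    have h4 : (gaussianReal 0 1).real (Set.Iio t) = 1 - p := by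
      rw [hp, ← Set.compl_Iio, probReal_compl_eq_one_sub measurableSet_Iio]
      ring
    rw [measureReal_def, h1, ENNReal.toReal_pow, ← measureReal_def, h4]
    have h5 : 1 - p ≤ Real.exp (-p) := by linarith [Real.add_one_le_exp (-p)]
    have h6 : 0 ≤ 1 - p := by rw [← h4]; exact measureReal_nonneg
    calc (1 - p) ^ Fintype.card ι ≤ Real.exp (-p) ^ Fintype.card ι := by gcongr
      _ = Real.exp (-(p * M)) := by rw [← Real.exp_nat_mul, hM]; ring_nf
      _ ≤ Real.exp (-1) := by gcongr
      _ ≤ 1 / 2 := by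
        rw [Real.exp_neg, one_div]
        have := Real.add_one_le_exp (1 : ℝ)
        gcongr
        linarith
  have hsup : ∀ ω i, Z i ω ≤ ⨆ i, Z i ω := fun ω i => 
    le_ciSup (f := fun i => Z i ω) (Set.finite_range _).bddAbove i
  have : Nonempty ι := ⟨i₀⟩
  have hI : Integrable (fun ω => ⨆ i, Z i ω) P := integrable_iSup hint
  -- Adding |Z_{i₀}| makes the maximum nonnegative, as Markov's inequality requires, at a cost of at
  -- most 1 in expectation.
  have h1 := mul_meas_ge_le_integral_of_nonneg (μ := P) (f := fun ω => (⨆ i, Z i ω) + |Z i₀ ω|)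
    (Filter.Eventually.of_forall fun ω => by
      have h2 := hsup ω i₀
      have h3 := neg_abs_le (Z i₀ ω)
      simp only [Pi.zero_apply]
      linarith) (hI.add (hint i₀).abs) t
  rw [integral_add hI (hint i₀).abs] at h1
  have h2 : 1 ≤ P.real {ω | t ≤ (⨆ i, Z i ω) + |Z i₀ ω|} + P.real {ω | ∀ i, Z i ω < t} := by
    rw [← probReal_univ (μ := P)]
    refine (measureReal_mono fun ω _ => ?_).trans (measureReal_union_le _ _)
    by_cases h : ∀ i, Z i ω < t
    · exact Or.inr h
    · left
      push Not at h
      obtain ⟨i, hi⟩ := h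
      have h3 := hsup ω i
      have h4 := abs_nonneg (Z i₀ ω)
      show t ≤ _
      linarith
  have h3 : t * (1 / 2) ≤ t * P.real {ω | t ≤ (⨆ i, Z i ω) + |Z i₀ ω|} := by
    gcongr; linarith
  linarith

end Gaussian

/-! ### Increments of bi-Laplacian fields; the union bound and the two-point bound. -/

section Field

variable {d n : ℕ} [NeZero n] {Ω : Type*} [MeasurableSpace Ω] {P : Measure Ω}
  {η : Torus d n → Ω → ℝ}

lemma neg_one_le_chi (ξ x : Torus d n) : -1 ≤ chi ξ x := by
  unfold chi
  obtain ⟨k, hk⟩ := ZMod.intCast_surjective (∑ i, ξ i * x i)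
  rw [← hk, re_stdAddChar_intCast]
  exact Real.neg_one_le_cos _

lemma neg_kern_zero_le (hd : 1 ≤ d) (p : ℕ) (x : Torus d n) : -kern d n p 0 ≤ kern d n p x := by
  unfold kern
  rw [← mul_neg, ← Finset.sum_neg_distrib]
  gcongr with ξ hξ
  rw [← mul_neg]
  have := symb_nonneg hd ξ
  gcongr
  rw [chi_zero_right]; exact neg_one_le_chi ξ x

/-- The covariance of a field on the torus. -/
noncomputable def fieldCov (η : Torus d n → Ω → ℝ) (P : Measure Ω) (x y : Torus d n) : ℝ :=
  ∫ ω, η x ω * η y ω ∂P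

namespace IsBiLaplacianField

lemma lap_lap_fieldCov (h : IsBiLaplacianField η P) (x y : Torus d n) :
    lap (lap fun z => fieldCov η P z y) x = (if x = y then 1 else 0) - 1 / (n : ℝ) ^ d :=
  h.bilaplace x y

lemma memLp (h : IsBiLaplacianField η P) (x : Torus d n) : MemLp (η x) 2 P :=
  (h.gaussian.eval x).memLp_two

lemma integrable (h : IsBiLaplacianField η P) (x : Torus d n) : Integrable (η x) P :=
  (h.gaussian.eval x).integrable

lemma neg (h : IsBiLaplacianField η P) : IsBiLaplacianField (fun x ω => -η x ω) P where
  gaussian := h.gaussian.fun_neg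
  centred x := by rw [integral_neg, h.centred, neg_zero]
  bilaplace x y := by simpa using h.bilaplace x y

lemma hasGaussianLaw_pi (h : IsBiLaplacianField η P) {κ : Type*} [Fintype κ]
    (a : κ → Torus d n → ℝ) : HasGaussianLaw (fun ω k => ∑ x, a k x * η x ω) P := by
  have := h.gaussian.map_fun (ContinuousLinearMap.pi fun k =>
    ∑ x, a k x • ContinuousLinearMap.proj (R := ℝ) (φ := fun _ : Torus d n => ℝ) x)
  refine this.congr (Filter.Eventually.of_forall fun ω => ?_)
  ext k
  simp

lemma integral_sum_mul (h : IsBiLaplacianField η P) (a : Torus d n → ℝ) (y : Torus d n) :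
    ∫ ω, (∑ x, a x * η x ω) * η y ω ∂P = ∑ x, a x * fieldCov η P x y := by
  simp only [Finset.sum_mul, mul_assoc]
  rw [integral_finsetSum]
  · simp only [integral_const_mul, fieldCov]
  · exact fun x _ => ((h.memLp x).integrable_mul (h.memLp y)).const_mul (a x)

lemma centredGaussian_sub (h : IsBiLaplacianField η P) (x y : Torus d n) :
    IsCentredGaussian (fun ω => η x ω - η y ω) P where
  law := (h.gaussian.prodMk x y).fun_sub
  mean := by rw [integral_sub (h.integrable x) (h.integrable y), h.centred, h.centred, sub_zero]

/-- The covariance and the kernel solve the same bi-Laplace equation, so they differ by a biharmonic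
function of the first variable, which is constant on the torus. -/
lemma fieldCov_sub (h : IsBiLaplacianField η P) (hd : 1 ≤ d) (x y z : Torus d n) :
    fieldCov η P x z - fieldCov η P y z = kern d n 2 (x - z) - kern d n 2 (y - z) := by
  have h1 : ∀ w, lap (lap fun w => fieldCov η P w z - kern d n 2 (w - z)) w = 0 := by
    intro w
    have h2 : (lap fun w => fieldCov η P w z - kern d n 2 (w - z)) =
        fun w => lap (fun w => fieldCov η P w z) w + kern d n 1 (w - z) := by
      ext w
      rw [lap_sub, lap_comp_sub, lap_kern_succ hd, sub_neg_eq_add]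
    rw [h2, lap_add, h.lap_lap_fieldCov, lap_comp_sub, lap_kern_succ hd, kern_zero]
    simp [sub_eq_zero]
  have h2 := eq_of_lap_eq_zero hd (lap_eq_zero_of_lap_lap_eq_zero h1) x y
  linarith

lemma integral_sub_sq (h : IsBiLaplacianField η P) (hd : 1 ≤ d) (x y : Torus d n) :
    ∫ ω, (η x ω - η y ω) ^ 2 ∂P = 2 * (kern d n 2 0 - kern d n 2 (x - y)) := by
  have h1 : ∀ ω, (η x ω - η y ω) ^ 2 =
      (η x ω * η x ω - η y ω * η x ω) + (η y ω * η y ω - η x ω * η y ω) := fun ω => by ring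
  have hi : ∀ x y, Integrable (fun ω => η x ω * η y ω) P := fun x y =>
    (h.memLp x).integrable_mul (h.memLp y)
  simp only [h1]
  have hi' : ∀ x y z, Integrable (fun ω => η x ω * η z ω - η y ω * η z ω) P := fun x y z =>
    (hi x z).sub (hi y z)
  rw [integral_add (hi' _ _ _) (hi' _ _ _), integral_sub (hi _ _) (hi _ _), integral_sub (hi _ _) (hi _ _)]
  have h2 := h.fieldCov_sub hd x y x
  have h3 := h.fieldCov_sub hd y x y
  simp only [fieldCov, sub_self] at h2 h3
  rw [h2, h3, ← kern_neg 2 (y - x), neg_sub]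
  ring

lemma integrable_iSup (h : IsBiLaplacianField η P) : Integrable (fun ω => ⨆ x, η x ω) P :=
  Sandpile.integrable_iSup h.integrable

/-- The variance of η itself is not determined by the equation, so the maximal inequality is applied
to η - η(0); subtracting the centred η(0) does not change the expected maximum. The increments have
variance at most 4G(0). -/
lemma integral_iSup_le_of_kern_le [IsProbabilityMeasure P] (h : IsBiLaplacianField η P)
    (hd : 1 ≤ d) (hn : 2 ≤ n) {K : ℝ} (hK : 0 < K) (hk : kern d n 2 0 ≤ K) :
    ∫ ω, ⨆ x, η x ω ∂P ≤ √(2 * (4 * K) * (d * Real.log n)) := by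
  have h1 : ∀ ω, (⨆ x, η x ω) ≤ (⨆ x, (η x ω - η 0 ω)) + η 0 ω := fun ω =>
    ciSup_le fun x => by
      have := le_ciSup (f := fun x => η x ω - η 0 ω) (Set.finite_range _).bddAbove x
      linarith
  have hi : Integrable (fun ω => ⨆ x, (η x ω - η 0 ω)) P :=
    Sandpile.integrable_iSup fun x => (h.integrable x).sub (h.integrable 0)
  have h2 := integral_mono h.integrable_iSup (hi.add (h.integrable 0)) h1
  refine h2.trans ?_
  have h3 : ∫ ω, ((fun ω => ⨆ x, (η x ω - η 0 ω)) + η 0) ω ∂P = ∫ ω, ⨆ x, (η x ω - η 0 ω) ∂P := by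
    simp only [Pi.add_apply]
    rw [integral_add hi (h.integrable 0), h.centred, add_zero]
  rw [h3]
  have hlog : 0 < Real.log n := Real.log_pos (by exact_mod_cast hn)
  have hd' : (0 : ℝ) < d := by exact_mod_cast hd
  refine integral_iSup_le (fun x => h.centredGaussian_sub x 0) (by positivity) (by positivity)
    (fun x => ?_) ?_
  · rw [h.integral_sub_sq hd]
    have := neg_kern_zero_le hd 2 (x - 0)
    linarith
  · rw [card_torus, Real.log_pow]

/-- The maximum over two points has mean E|η(p) - η(0)|/2. With `p` half-way round the torus, the
single lowest frequency `e` gives a variance of order n^{4-d}. -/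
lemma integral_iSup_ge (h : IsBiLaplacianField η P) (hd : 1 ≤ d) (hn : 2 ≤ n) :
    absMoment / 40 * √(1 / (n : ℝ) ^ d * n ^ 4) ≤ ∫ ω, ⨆ x, η x ω ∂P := by
  have hn' : (0 : ℝ) < n := by positivity
  have hd' : (0 : ℝ) < d := by exact_mod_cast hd
  have : Fact (1 < n) := ⟨hn⟩
  let i₀ : Fin d := ⟨0, hd⟩
  let p : Torus d n := Pi.single i₀ ((n / 2 : ℕ) : ZMod n)
  let e : Torus d n := Pi.single i₀ 1
  have he : e ≠ 0 := by simp [e]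
  have hchi : 8 / 9 ≤ 1 - chi e p := by
    have h1 : ∑ i, e i * p i = ((n / 2 : ℕ) : ZMod n) := by
      simp [e, p, Pi.single_apply]
    rw [chi, h1]
    refine le_trans ?_ (one_sub_re_stdAddChar_ge _)
    rw [ZMod.valMinAbs_natCast_of_le_half le_rfl, Int.natAbs_natCast]
    -- The worst case is n = 3, because of the rounding in n / 2.
    have h2 : (1 / 3 : ℝ) ≤ ((n / 2 : ℕ) : ℝ) / n := by
      rw [div_le_div_iff₀ (by norm_num) hn']
      have : 1 * n ≤ n / 2 * 3 := by omega
      exact_mod_cast this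
    nlinarith
  have hsymb : symb e ≤ 20 / (n : ℝ) ^ 2 := by
    have h1 : ∀ i, 1 - (ZMod.stdAddChar (e i) : ℂ).re ≤ if i = i₀ then 20 / (n : ℝ) ^ 2 else 0 := by
      intro i
      split_ifs with hi
      · have h2 : e i = ((1 : ℤ) : ZMod n) := by simp [e, hi]
        rw [h2, re_stdAddChar_intCast]
        have h3 := Real.one_sub_sq_div_two_le_cos (x := 2 * Real.pi * (1 : ℤ) / n)
        have h4 : (2 * Real.pi * ((1 : ℤ) : ℝ) / n) ^ 2 / 2 ≤ 20 / (n : ℝ) ^ 2 := by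
          rw [div_pow, div_right_comm]
          gcongr
          push_cast
          nlinarith [Real.pi_lt_d2, Real.pi_pos]
        linarith
      · simp [e, hi]
    rw [symb]
    have h2 := Finset.sum_le_sum fun i (_ : i ∈ Finset.univ) => h1 i
    rw [Finset.sum_ite_eq' Finset.univ i₀, if_pos (Finset.mem_univ _)] at h2
    have h3 : 1 / (d : ℝ) ≤ 1 := by rw [div_le_one hd']; exact_mod_cast hd
    calc _ ≤ 1 / (d : ℝ) * (20 / (n : ℝ) ^ 2) := by gcongr
      _ ≤ 1 * (20 / (n : ℝ) ^ 2) := by gcongr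
      _ = _ := one_mul _
  have hvar : (1 / 20) ^ 2 * (1 / (n : ℝ) ^ d * n ^ 4) ≤ ∫ ω, (η p ω - η 0 ω) ^ 2 ∂P := by
    rw [h.integral_sub_sq hd, sub_zero]
    have h1 : kern d n 2 0 - kern d n 2 p = 1 / (n : ℝ) ^ d *
        ∑ ξ ∈ Finset.univ.erase (0 : Torus d n), (symb ξ ^ 2)⁻¹ * (1 - chi ξ p) := by
      simp only [kern, chi_zero_right, mul_sub, Finset.sum_sub_distrib]
    have h2 : (symb e ^ 2)⁻¹ * (1 - chi e p) ≤
        ∑ ξ ∈ Finset.univ.erase (0 : Torus d n), (symb ξ ^ 2)⁻¹ * (1 - chi ξ p) :=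
      Finset.single_le_sum (f := fun ξ => (symb ξ ^ 2)⁻¹ * (1 - chi ξ p)) (fun ξ _ =>
        mul_nonneg (by positivity) (by linarith [chi_le_one ξ p]))
        (Finset.mem_erase.2 ⟨he, Finset.mem_univ _⟩)
    have h3 : ((20 / (n : ℝ) ^ 2) ^ 2)⁻¹ * (8 / 9) ≤ (symb e ^ 2)⁻¹ * (1 - chi e p) := by
      have := symb_pos hd he
      gcongr
    rw [h1]
    calc _ ≤ 2 * (1 / (n : ℝ) ^ d * (((20 / (n : ℝ) ^ 2) ^ 2)⁻¹ * (8 / 9))) := by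
          rw [show ((20 / (n : ℝ) ^ 2) ^ 2)⁻¹ * (8 / 9) = (n : ℝ) ^ 4 * (1 / 450) by
            field_simp; norm_num]
          have : 0 ≤ 1 / (n : ℝ) ^ d * n ^ 4 := by positivity
          linarith
      _ ≤ _ := by gcongr; exact h3.trans h2
  have hD := h.centredGaussian_sub p 0
  have h1 : ∀ ω, (η p ω - η 0 ω + |η p ω - η 0 ω|) / 2 + η 0 ω ≤ ⨆ x, η x ω := by
    intro ω
    have h2 := le_ciSup (f := fun x => η x ω) (Set.finite_range _).bddAbove p
    have h3 := le_ciSup (f := fun x => η x ω) (Set.finite_range _).bddAbove 0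
    rcases abs_cases (η p ω - η 0 ω) with ⟨h4, _⟩ | ⟨h4, _⟩ <;> rw [h4] <;> linarith
  have hi := hD.law.integrable
  have h2 : ∫ ω, ((η p ω - η 0 ω + |η p ω - η 0 ω|) / 2 + η 0 ω) ∂P ≤ ∫ ω, ⨆ x, η x ω ∂P :=
    integral_mono (((hi.add hi.abs).div_const 2).add (h.integrable 0)) h.integrable_iSup h1
  refine le_trans ?_ h2
  have hi' : Integrable (fun ω => η p ω - η 0 ω + |η p ω - η 0 ω|) P := hi.add hi.abs
  rw [integral_add (hi'.div_const 2) (h.integrable 0), integral_div,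
    integral_add hi hi.abs, hD.mean, hD.integral_abs, h.centred]
  have h3 : 1 / 20 * √(1 / (n : ℝ) ^ d * n ^ 4) ≤ √(∫ ω, (η p ω - η 0 ω) ^ 2 ∂P) := by
    rw [show (1 / 20 : ℝ) = √((1 / 20) ^ 2) by simp, ← Real.sqrt_mul (by positivity)]
    exact Real.sqrt_le_sqrt hvar
  have := absMoment_pos
  calc _ = (1 / 20 * √(1 / (n : ℝ) ^ d * n ^ 4)) * absMoment / 2 := by ring
    _ ≤ (√(∫ ω, (η p ω - η 0 ω) ^ 2 ∂P)) * absMoment / 2 := by gcongr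
    _ = _ := by ring

end IsBiLaplacianField

end Field

/-! ### Dyadic chaining: the upper bound in dimensions at most three. -/

section Chaining

variable {d n : ℕ} [NeZero n] {Ω : Type*} [MeasurableSpace Ω] {P : Measure Ω}
  {η : Torus d n → Ω → ℝ}

/-- The point of the torus with coordinates `m * a i`. -/
def gridPt (d n m : ℕ) (a : Fin d → ℕ) : Torus d n := fun i => ((m * a i : ℕ) : ZMod n)

lemma succ_le_geometric (j : ℕ) : ((j : ℝ) + 1) ≤ 8 * (9 / 8) ^ j := by
  have := one_add_mul_le_pow (a := (1 / 8 : ℝ)) (by norm_num) j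
  have h : (1 + 1 / 8 : ℝ) = 9 / 8 := by norm_num
  rw [h] at this
  linarith

/-- The entropy j + 1 at level j is absorbed by the decay of the variance: j + 1 ≤ 8(9/8)^j, √(1/2)
≤ 18/25, and (18/25)(9/8) = (9/10)². -/
lemma sqrt_geometric_le {A B : ℝ} (hA : 0 ≤ A) (hB : 0 ≤ B) (j : ℕ) {m : ℝ}
    (hm : m ≤ (1 / 2) ^ j) :
    √(2 * (A * √m) * (B * (j + 1))) ≤ √(16 * A * B) * (9 / 10) ^ j := by
  have h1 : √m ≤ (18 / 25) ^ j := by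
    refine (Real.sqrt_le_sqrt hm).trans ?_
    rw [Real.sqrt_le_left (by positivity), ← pow_mul, mul_comm, pow_mul]
    gcongr
    norm_num
  have h2 := succ_le_geometric j
  rw [show ((9 / 10 : ℝ) ^ j) = √(((9 / 10) ^ j) ^ 2) by rw [Real.sqrt_sq (by positivity)],
    ← Real.sqrt_mul (by positivity)]
  refine Real.sqrt_le_sqrt ?_
  calc 2 * (A * √m) * (B * (j + 1)) ≤ 2 * (A * (18 / 25) ^ j) * (B * (8 * (9 / 8) ^ j)) := by gcongr
    _ = 16 * A * B * ((18 / 25) * (9 / 8)) ^ j := by rw [mul_pow]; ring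
    _ ≤ 16 * A * B * ((9 / 10) ^ 2) ^ j := by gcongr; norm_num
    _ = _ := by rw [← pow_mul, ← pow_mul, mul_comm 2]

/-- Telescoping over the points obtained by rounding the coordinates of x down to multiples of
2^(J-j). At j = 0 this is the origin since all coordinates are below 2^J. The parent of the fine
index a is written 2(a/2) on the same fine grid, so both ends of an increment use one mesh size. -/
lemma eq_add_sum_increments (f : Torus d n → ℝ) {J : ℕ} (hJ : n ≤ 2 ^ J) (x : Torus d n) :
    f x = f 0 + ∑ j ∈ Finset.range J,
      (f (gridPt d n (2 ^ (J - 1 - j)) fun i => (x i).val / 2 ^ (J - 1 - j)) -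
        f (gridPt d n (2 ^ (J - 1 - j)) fun i => 2 * ((x i).val / 2 ^ (J - 1 - j) / 2))) := by
  set F : ℕ → ℝ := fun j => f (gridPt d n (2 ^ (J - j)) fun i => (x i).val / 2 ^ (J - j)) with hF
  have h1 : ∀ j ∈ Finset.range J,
      (f (gridPt d n (2 ^ (J - 1 - j)) fun i => (x i).val / 2 ^ (J - 1 - j)) -
        f (gridPt d n (2 ^ (J - 1 - j)) fun i => 2 * ((x i).val / 2 ^ (J - 1 - j) / 2)))
      = F (j + 1) - F j := by
    intro j hj
    rw [Finset.mem_range] at hj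
    simp only [hF]
    rw [show J - (j + 1) = J - 1 - j by omega]
    congr 2
    ext i
    simp only [gridPt]
    rw [Nat.div_div_eq_div_mul, ← mul_assoc, ← pow_succ, show J - 1 - j + 1 = J - j by omega]
  rw [Finset.sum_congr rfl h1, Finset.sum_range_sub]
  have h2 : F J = f x := by
    simp only [hF, Nat.sub_self, pow_zero, Nat.div_one]
    congr 1
    ext i
    simp [gridPt]
  have h3 : F 0 = f 0 := by
    simp only [hF, Nat.sub_zero]
    congr 1
    ext i
    rw [gridPt, Nat.div_eq_of_lt (lt_of_lt_of_le (ZMod.val_lt (x i)) hJ)]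
    simp
  rw [h2, h3]
  ring

lemma IsBiLaplacianField.integral_iSup_le_of_le_three [IsProbabilityMeasure P]
    (h : IsBiLaplacianField η P) (hd : 1 ≤ d) (hd3 : d ≤ 3) (hn : 2 ≤ n) :
    ∫ ω, ⨆ x, η x ω ∂P ≤ 10 * √(16 * 400000 * 3) * √(1 / (n : ℝ) ^ d * n ^ 4) := by
  have hn' : (0 : ℝ) < n := by positivity
  set J := Nat.clog 2 n with hJdef
  have hJ : n ≤ 2 ^ J := Nat.le_pow_clog one_lt_two n
  have hJ1 : 2 ^ (J - 1) < n := Nat.pow_pred_clog_lt_self one_lt_two hn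
  set S := 1 / (n : ℝ) ^ d * n ^ 4 with hS
  have hS0 : 0 < S := by positivity
  have hd3' : (d : ℝ) ≤ 3 := by exact_mod_cast hd3
  have hd' : (0 : ℝ) < d := by exact_mod_cast hd
  -- The increments of level j are indexed by the fine point alone, since it determines its parent;
  -- this gives 2^{(j+1)d} of them.
  let D : (j : ℕ) → (Fin d → Fin (2 ^ (j + 1))) → Ω → ℝ := fun j a ω =>
    η (gridPt d n (2 ^ (J - 1 - j)) fun i => (a i : ℕ)) ω -
      η (gridPt d n (2 ^ (J - 1 - j)) fun i => 2 * ((a i : ℕ) / 2)) ω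
  have hD : ∀ j a, IsCentredGaussian (D j a) P := fun j a => h.centredGaussian_sub _ _
  have hDint : ∀ j, Integrable (fun ω => ⨆ a, D j a ω) P := fun j =>
    Sandpile.integrable_iSup fun a => (hD j a).law.integrable
  have hpt : ∀ ω, (⨆ x, η x ω) ≤ η 0 ω + ∑ j ∈ Finset.range J, ⨆ a, D j a ω := by
    intro ω
    refine ciSup_le fun x => ?_
    rw [eq_add_sum_increments (fun x => η x ω) hJ x]
    gcongr with j hj
    rw [Finset.mem_range] at hj
    have hlt : ∀ i, (x i).val / 2 ^ (J - 1 - j) < 2 ^ (j + 1) := fun i => by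
      rw [Nat.div_lt_iff_lt_mul (by positivity), ← pow_add,
        show j + 1 + (J - 1 - j) = J by omega]
      exact lt_of_lt_of_le (ZMod.val_lt (x i)) hJ
    exact le_ciSup (f := fun a => D j a ω) (Set.finite_range _).bddAbove fun i => ⟨_, hlt i⟩
  have h1 : ∫ ω, ⨆ x, η x ω ∂P ≤
      ∫ ω, (η 0 ω + ∑ j ∈ Finset.range J, ⨆ a, D j a ω) ∂P :=
    integral_mono h.integrable_iSup
      ((h.integrable 0).add (integrable_finsetSum _ fun j _ => hDint j)) hpt
  rw [integral_add (h.integrable 0) (integrable_finsetSum _ fun j _ => hDint j), h.centred,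
    zero_add, integral_finsetSum _ fun j _ => hDint j] at h1
  have h2 : ∀ j ∈ Finset.range J,
      ∫ ω, ⨆ a, D j a ω ∂P ≤ √(16 * (400000 * S) * 3) * (9 / 10) ^ j := by
    intro j hj
    rw [Finset.mem_range] at hj
    set m : ℝ := ((2 ^ (J - 1 - j) : ℕ) : ℝ) with hm
    have hm0 : 0 < m := by positivity
    have hmn : m / n ≤ (1 / 2) ^ j := by
      have h3 : (2 : ℝ) ^ (J - 1 - j) * 2 ^ j ≤ n := by
        rw [← pow_add, show J - 1 - j + j = J - 1 by omega]
        exact_mod_cast hJ1.le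
      rw [div_le_iff₀ hn', one_div, inv_pow, inv_mul_eq_div, le_div_iff₀ (by positivity)]
      simpa [m] using h3
    refine le_trans ?_ (sqrt_geometric_le (by positivity) (by norm_num) j hmn)
    refine integral_iSup_le (hD j) (by positivity) (by positivity) (fun a => ?_) ?_
    · rw [h.integral_sub_sq hd]
      -- A point and its parent differ by mesh size times a mod 2 in each coordinate, hence by at
      -- most the mesh size.
      have h3 := kern_two_zero_sub_le hd hd3
        ((gridPt d n (2 ^ (J - 1 - j)) fun i => (a i : ℕ)) -
          (gridPt d n (2 ^ (J - 1 - j)) fun i => 2 * ((a i : ℕ) / 2)))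
        (fun i => ((2 ^ (J - 1 - j) * ((a i : ℕ) % 2) : ℕ) : ℤ)) m (fun i => ?_) (fun i => ?_)
      · linarith
      · have h4 : (a i : ℕ) % 2 + 2 * ((a i : ℕ) / 2) = a i := Nat.mod_add_div _ _
        simp only [gridPt, Pi.sub_apply, Int.cast_natCast]
        rw [sub_eq_iff_eq_add, ← Nat.cast_add, ← mul_add, h4]
      · have h4 : (a i : ℕ) % 2 ≤ 1 := by omega
        rw [Int.cast_natCast, Nat.abs_cast, hm]
        exact_mod_cast (Nat.mul_le_mul_left _ h4).trans (by simp)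
    · have hl : Real.log 2 ≤ 1 := by linarith [Real.log_two_lt_d9]
      simp only [Fintype.card_pi, Fintype.card_fin, Finset.prod_const, Finset.card_univ]
      rw [← pow_mul, Nat.cast_pow, Real.log_pow]
      push_cast
      calc ((j : ℝ) + 1) * d * Real.log 2 ≤ (j + 1) * 3 * 1 := by gcongr
        _ = _ := by ring
  refine h1.trans ((Finset.sum_le_sum h2).trans ?_)
  rw [← Finset.mul_sum, show 16 * (400000 * S) * 3 = 16 * 400000 * 3 * S by ring,
    Real.sqrt_mul (by norm_num)]
  have h3 : ∑ j ∈ Finset.range J, (9 / 10 : ℝ) ^ j ≤ 10 := by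
    have h4 : ∑' j : ℕ, (9 / 10 : ℝ) ^ j = 10 := by
      rw [tsum_geometric_of_lt_one (by norm_num) (by norm_num)]; norm_num
    exact ((summable_geometric_of_lt_one (by norm_num) (by norm_num)).sum_le_tsum _
      fun j _ => by positivity).trans h4.le
  calc _ ≤ √(16 * 400000 * 3) * √S * 10 := by gcongr
    _ = _ := by ring

end Chaining

/-! ### Lower bound by independent bumps. -/

section Lower

lemma measurable_iSup_add {ι : Type*} [Countable ι] :
    Measurable (fun p : (ι → ℝ) × (ι → ℝ) => ⨆ i, (p.1 i + p.2 i)) :=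
  Measurable.iSup fun i => ((measurable_pi_apply i).comp measurable_fst).add
    ((measurable_pi_apply i).comp measurable_snd)

/-- Jensen's inequality for the maximum, conditionally on X: integrating out the independent centred
R leaves at least max X. -/
lemma integral_iSup_le_integral_iSup_add {Ω : Type*} [MeasurableSpace Ω] {P : Measure Ω}
    [IsProbabilityMeasure P] {ι : Type*} [Finite ι] [Nonempty ι] {X R : ι → Ω → ℝ}
    (hX : ∀ i, Integrable (X i) P) (hR : ∀ i, Integrable (R i) P) (hmean : ∀ i, ∫ ω, R i ω ∂P = 0)
    (hind : IndepFun (fun ω i => X i ω) (fun ω i => R i ω) P) :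
    ∫ ω, ⨆ i, X i ω ∂P ≤ ∫ ω, ⨆ i, (X i ω + R i ω) ∂P := by
  have hXm : AEMeasurable (fun ω i => X i ω) P := aemeasurable_pi_lambda _ fun i => (hX i).aemeasurable
  have hRm : AEMeasurable (fun ω i => R i ω) P := aemeasurable_pi_lambda _ fun i => (hR i).aemeasurable
  have hprod := (indepFun_iff_map_prod_eq_prod_map_map hXm hRm).1 hind
  have := Measure.isProbabilityMeasure_map hXm
  have := Measure.isProbabilityMeasure_map hRm
  set μX := P.map (fun ω i => X i ω)
  set μR := P.map (fun ω i => R i ω)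
  have hF : Integrable (fun p : (ι → ℝ) × (ι → ℝ) => ⨆ i, (p.1 i + p.2 i)) (μX.prod μR) := by
    rw [← hprod, integrable_map_measure measurable_iSup_add.aestronglyMeasurable (hXm.prodMk hRm)]
    exact integrable_iSup fun i => (hX i).add (hR i)
  have hri : ∀ i, Integrable (fun r : ι → ℝ => r i) μR := fun i => by
    rw [integrable_map_measure (measurable_pi_apply i).aestronglyMeasurable hRm]
    exact hR i
  have h1 : ∫ ω, ⨆ i, (X i ω + R i ω) ∂P = ∫ x, ∫ r, ⨆ i, (x i + r i) ∂μR ∂μX := by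
    rw [← integral_prod (fun p : (ι → ℝ) × (ι → ℝ) => ⨆ i, (p.1 i + p.2 i)) hF, ← hprod,
      integral_map (hXm.prodMk hRm) measurable_iSup_add.aestronglyMeasurable]
  have h2 : ∫ ω, ⨆ i, X i ω ∂P = ∫ x, ⨆ i, x i ∂μX := by
    rw [integral_map hXm (Measurable.iSup fun i => measurable_pi_apply i).aestronglyMeasurable]
  rw [h1, h2]
  refine integral_mono ?_ hF.integral_prod_left fun x => ciSup_le fun i => ?_
  · rw [integrable_map_measure
      (Measurable.iSup fun i => measurable_pi_apply i).aestronglyMeasurable hXm]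
    exact integrable_iSup hX
  · have h3 : ∫ r : ι → ℝ, (x i + r i) ∂μR = x i := by
      have h4 : ∫ r : ι → ℝ, r i ∂μR = 0 := by
        rw [integral_map hRm (measurable_pi_apply i).aestronglyMeasurable, hmean]
      rw [integral_add (integrable_const _) (hri i), h4]
      simp
    calc x i = ∫ r : ι → ℝ, (x i + r i) ∂μR := h3.symm
      _ ≤ _ := integral_mono ((integrable_const _).add (hri i))
          (integrable_iSup fun i => (integrable_const (x i)).add (hri i))
          fun r => le_ciSup (f := fun i => x i + r i) (Set.finite_range _).bddAbove i

variable {d n : ℕ} [NeZero n] {Ω : Type*} [MeasurableSpace Ω] {P : Measure Ω}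
  {η : Torus d n → Ω → ℝ}

namespace IsBiLaplacianField

lemma memLp_sum (h : IsBiLaplacianField η P) (a : Torus d n → ℝ) :
    MemLp (fun ω => ∑ x, a x * η x ω) 2 P :=
  memLp_finsetSum _ fun x _ => (h.memLp x).const_mul (a x)

lemma integral_sum_eq_zero (h : IsBiLaplacianField η P) (a : Torus d n → ℝ) :
    ∫ ω, ∑ x, a x * η x ω ∂P = 0 := by
  rw [integral_finsetSum _ fun x _ => (h.integrable x).const_mul (a x)]
  simp [integral_const_mul, h.centred]

lemma integral_sum_lap_lap_mul (h : IsBiLaplacianField η P) (ψ c : Torus d n → ℝ) :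
    ∫ ω, (∑ x, lap (lap ψ) x * η x ω) * (∑ y, c y * η y ω) ∂P =
      ∑ y, c y * (ψ y - 1 / (n : ℝ) ^ d * ∑ x, ψ x) := by
  simp only [Finset.mul_sum, mul_left_comm _ (c _)]
  rw [integral_finsetSum]
  · refine Finset.sum_congr rfl fun y _ => ?_
    rw [integral_const_mul, h.integral_sum_mul, sum_lap_mul, sum_lap_mul]
    congr 1
    simp only [h.lap_lap_fieldCov, mul_sub, Finset.sum_sub_distrib, ← Finset.sum_mul, mul_ite,
      mul_one, mul_zero, Finset.sum_ite_eq', Finset.mem_univ, if_true]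
    rw [Finset.sum_mul]
    simp only [mul_comm]
  · exact fun y _ => ((h.memLp_sum _).integrable_mul (h.memLp y)).const_mul (c y)

/-- Testing η against Δ²ψ_k inverts the covariance up to means: the covariance of ⟨Δ²ψ_k, η⟩ with
η(y) is ψ_k(y) minus the mean of ψ_k. Orthogonality of the Δψ_k therefore makes the Z_k i.i.d.
standard. -/
lemma integral_iSup_ge_of_bumps [IsProbabilityMeasure P] (h : IsBiLaplacianField η P)
    {ι : Type*} [Fintype ι] [Nonempty ι] [DecidableEq ι] (ψ : ι → Torus d n → ℝ) (x : ι → Torus d n)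
    {τ : ℝ} (hτ : 0 < τ) (hψ : ∀ k l, ∑ z, lap (ψ k) z * lap (ψ l) z = if k = l then τ else 0)
    (hx : ∀ k l, ψ k (x l) = if k = l then 1 else 0) (hcard : 36 ≤ Real.log (Fintype.card ι)) :
    (√τ)⁻¹ * (1 / 4 * √(Real.log (Fintype.card ι))) ≤ ∫ ω, ⨆ x, η x ω ∂P := by
  set s := (√τ)⁻¹ with hs
  have hs0 : 0 < s := by positivity
  have hsτ : s * s * τ = 1 := by
    rw [hs, ← mul_inv, Real.mul_self_sqrt hτ.le, inv_mul_cancel₀ hτ.ne']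
  set m : ι → ℝ := fun k => 1 / (n : ℝ) ^ d * ∑ z, ψ k z with hm
  let a : ι → Torus d n → ℝ := fun k z => s * lap (lap (ψ k)) z
  -- Coefficients of the residual of η(x_k) after regression on the Z_l: the regression coefficients
  -- are s(ψ_l(x_k) - m_l) = s(1_{k=l} - m_l).
  let c : ι → Torus d n → ℝ := fun k z =>
    (if z = x k then 1 else 0) - s * (a k z - ∑ l, m l * a l z)
  let Z : ι → Ω → ℝ := fun k ω => ∑ z, a k z * η z ω
  let R : ι → Ω → ℝ := fun k ω => ∑ z, c k z * η z ω
  have hZc : ∀ k (b : Torus d n → ℝ), ∫ ω, Z k ω * (∑ z, b z * η z ω) ∂P =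
      s * ∑ z, b z * (ψ k z - m k) := by
    intro k b
    simp only [Z, a, mul_assoc, ← Finset.mul_sum _ _ s]
    rw [integral_const_mul, h.integral_sum_lap_lap_mul]
  have hsum : ∀ k l, ∑ z, a l z * (ψ k z - m k) = if k = l then s * τ else 0 := by
    intro k l
    simp only [a, mul_sub, Finset.sum_sub_distrib, mul_assoc, ← Finset.mul_sum, ← Finset.sum_mul,
      sum_lap, zero_mul, mul_zero, sub_zero]
    rw [sum_lap_mul, ← mul_ite_zero, ← hψ]
    simp only [mul_comm]
  have hZZ : ∀ k l, ∫ ω, Z k ω * Z l ω ∂P = if k = l then 1 else 0 := by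
    intro k l
    rw [hZc, hsum, mul_ite, mul_zero, ← mul_assoc, hsτ]
  have hZR : ∀ k l, ∫ ω, Z k ω * R l ω ∂P = 0 := by
    intro k l
    rw [hZc]
    have h1 : ∑ z, c l z * (ψ k z - m k) = (ψ k (x l) - m k) -
        s * (∑ z, a l z * (ψ k z - m k) - ∑ j, m j * ∑ z, a j z * (ψ k z - m k)) := by
      simp only [c, sub_mul, Finset.sum_sub_distrib, ite_mul, one_mul, zero_mul,
        Finset.sum_ite_eq', Finset.mem_univ, if_true]
      congr 1
      simp only [mul_sub, sub_mul, Finset.sum_sub_distrib, Finset.mul_sum, Finset.sum_mul]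
      rw [Finset.sum_comm (γ := ι), Finset.sum_comm (γ := ι)]
      simp only [mul_assoc]
      ring
    rw [h1, hx]
    simp only [hsum, mul_ite, mul_zero, Finset.sum_ite_eq, Finset.mem_univ, if_true]
    have h2 : s * (m k * (s * τ)) = m k := by
      rw [show s * (m k * (s * τ)) = m k * (s * s * τ) by ring, hsτ, mul_one]
    have h3 : s * (s * τ) = 1 := by rw [← mul_assoc, hsτ]
    split_ifs
    · rw [mul_sub s (s * τ), h2, h3]; ring
    · rw [mul_sub s 0, h2]; ring
  have hZmean : ∀ k, ∫ ω, Z k ω ∂P = 0 := fun k => h.integral_sum_eq_zero _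
  have hRmean : ∀ k, ∫ ω, R k ω ∂P = 0 := fun k => h.integral_sum_eq_zero _
  have hcov : ∀ {X Y : Ω → ℝ}, MemLp X 2 P → MemLp Y 2 P → ∫ ω, X ω ∂P = 0 →
      cov[X, Y; P] = ∫ ω, X ω * Y ω ∂P := by
    intro X Y hX hY hX0
    rw [covariance_eq_sub hX hY, hX0, zero_mul, sub_zero]
    rfl
  have hZgauss : HasGaussianLaw (fun ω k => Z k ω) P := h.hasGaussianLaw_pi a
  have hZmem : ∀ k, MemLp (Z k) 2 P := fun k => h.memLp_sum _
  have hRmem : ∀ k, MemLp (R k) 2 P := fun k => h.memLp_sum _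
  have hZint : ∀ k, Integrable (Z k) P := fun k => (hZmem k).integrable (by norm_num)
  have hRint : ∀ k, Integrable (R k) P := fun k => (hRmem k).integrable (by norm_num)
  have hZind : iIndepFun Z P := hZgauss.iIndepFun_of_covariance_eq_zero fun k l hkl => by
    rw [hcov (hZmem k) (hZmem l) (hZmean k), hZZ, if_neg hkl]
  have hZlaw : ∀ k, P.map (Z k) = gaussianReal 0 1 := fun k => by
    have h1 : IsCentredGaussian (Z k) P := ⟨hZgauss.eval k, hZmean k⟩
    rw [h1.map_eq]
    simp only [pow_two, hZZ, if_true, Real.toNNReal_one]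
  have hjoint : HasGaussianLaw (fun ω => ((fun k => Z k ω), (fun k => R k ω))) P := by
    have h1 := h.hasGaussianLaw_pi (κ := ι ⊕ ι) (Sum.elim a c)
    exact h1.map_fun ((ContinuousLinearMap.pi fun k =>
      ContinuousLinearMap.proj (R := ℝ) (φ := fun _ : ι ⊕ ι => ℝ) (Sum.inl k)).prod
      (ContinuousLinearMap.pi fun k =>
        ContinuousLinearMap.proj (R := ℝ) (φ := fun _ : ι ⊕ ι => ℝ) (Sum.inr k)))
  have hindep : IndepFun (fun ω k => Z k ω) (fun ω k => R k ω) P :=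
    hjoint.indepFun_of_covariance_eval fun k l => by
      rw [hcov (hZmem k) (hRmem l) (hZmean k), hZR]
  have hindep' : IndepFun (fun ω k => s * Z k ω) (fun ω k => R k ω) P :=
    hindep.comp (φ := fun z k => s * z k) (ψ := id) (by fun_prop) measurable_id
  have h1 := integral_iSup_le_integral_iSup_add (fun k => (hZint k).const_mul s) hRint hRmean hindep'
  have h2 := integral_iSup_indep_ge hZind hZlaw hcard
  have h3 : ∫ ω, ⨆ k, s * Z k ω ∂P = s * ∫ ω, ⨆ k, Z k ω ∂P := by
    rw [← integral_const_mul]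
    simp only [Real.mul_iSup_of_nonneg hs0.le]
  have h4 : ∀ k ω, η (x k) ω = s * Z k ω + R k ω - s * ∑ l, m l * Z l ω := by
    intro k ω
    simp only [R, c, Z, sub_mul, Finset.sum_sub_distrib, ite_mul, one_mul, zero_mul,
      Finset.sum_ite_eq', Finset.mem_univ, if_true, mul_sub, Finset.mul_sum, Finset.sum_mul]
    rw [Finset.sum_comm (γ := ι)]
    simp only [mul_assoc]
    ring
  have hT : Integrable (fun ω => s * ∑ l, m l * Z l ω) P :=
    (integrable_finsetSum _ fun l _ => (hZint l).const_mul _).const_mul _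
  have hT0 : ∫ ω, s * ∑ l, m l * Z l ω ∂P = 0 := by
    rw [integral_const_mul, integral_finsetSum _ fun l _ => (hZint l).const_mul _]
    simp [integral_const_mul, hZmean]
  have hI : Integrable (fun ω => ⨆ k, (s * Z k ω + R k ω)) P :=
    Sandpile.integrable_iSup fun k => ((hZint k).const_mul s).add (hRint k)
  -- The correction from the means m_l is the same for all k and centred, so it leaves the maximum
  -- and disappears in expectation.
  have h5 : ∀ ω, (⨆ k, (s * Z k ω + R k ω)) - s * ∑ l, m l * Z l ω ≤ ⨆ x, η x ω := by
    intro ω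
    rw [sub_le_iff_le_add]
    refine ciSup_le fun k => ?_
    have h6 := le_ciSup (f := fun x => η x ω) (Set.finite_range _).bddAbove (x k)
    have h7 := h4 k ω
    linarith
  have h6 := integral_mono (hI.sub hT) h.integrable_iSup h5
  have h7 : ∫ ω, ((fun ω => ⨆ k, (s * Z k ω + R k ω)) - fun ω => s * ∑ l, m l * Z l ω) ω ∂P =
      ∫ ω, ⨆ k, (s * Z k ω + R k ω) ∂P := by
    rw [integral_sub' hI hT, hT0, sub_zero]
  rw [h7] at h6
  calc s * (1 / 4 * √(Real.log (Fintype.card ι))) ≤ s * ∫ ω, ⨆ k, Z k ω ∂P := by gcongr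
    _ = _ := h3.symm
    _ ≤ _ := h1
    _ ≤ _ := h6

end IsBiLaplacianField

omit [NeZero n] in
-- Centres of the bumps, placed along one axis only: since just log M matters, M of order n/R is
-- enough. The differences lie between 2R and n - 2R in absolute value, so they stay apart modulo n
-- as well.
lemma le_rad_sub_of_ne (hd : 1 ≤ d) {R M : ℕ} (hRM : 2 * R * M ≤ n) {k l : ℕ} (hk : k < M)
    (hl : l < M) (hkl : k ≠ l) :
    2 * R ≤ rad ((Pi.single ⟨0, hd⟩ ((2 * R * k : ℕ) : ZMod n) : Torus d n) -
      Pi.single ⟨0, hd⟩ ((2 * R * l : ℕ) : ZMod n)) := by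
  refine le_trans ?_ (natAbs_le_rad _ ⟨0, hd⟩)
  rw [Pi.sub_apply, Pi.single_eq_same, Pi.single_eq_same]
  set z : ZMod n := ((2 * R * k : ℕ) : ZMod n) - ((2 * R * l : ℕ) : ZMod n) with hz
  set D : ℤ := 2 * R * ((k : ℤ) - l) with hD
  have h1 : (z.valMinAbs : ZMod n) = (D : ZMod n) := by
    rw [ZMod.coe_valMinAbs, hz, hD]; push_cast; ring
  obtain ⟨q, hq⟩ := (ZMod.intCast_eq_intCast_iff_dvd_sub _ _ _).1 h1
  have hDlow : (2 * R : ℤ) ≤ |D| := by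
    rw [hD, abs_mul]
    have h2 : 1 ≤ |(k : ℤ) - l| := Int.one_le_abs (by omega)
    have h3 : |(2 * R : ℤ)| = 2 * R := abs_of_nonneg (by positivity)
    rw [h3]
    nlinarith
  have hDup : |D| ≤ n - 2 * R := by
    rw [hD, abs_mul]
    have h2 : |(k : ℤ) - l| ≤ M - 1 := by rw [abs_le]; omega
    have h3 : |(2 * R : ℤ)| = 2 * R := abs_of_nonneg (by positivity)
    have h4 : (2 * R * M : ℤ) ≤ n := by exact_mod_cast hRM
    rw [h3]
    nlinarith
  have h2 : (2 * R : ℤ) ≤ |z.valMinAbs| := by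
    have h3 : z.valMinAbs = D - n * q := by linarith
    rw [h3]
    rcases eq_or_ne q 0 with rfl | hq0
    · simpa using hDlow
    · have h4 : (n : ℤ) ≤ |(n : ℤ) * q| := by
        rw [abs_mul, Nat.abs_cast]
        have := Int.one_le_abs hq0
        nlinarith [Int.natCast_nonneg n]
      have h5 := abs_sub_abs_le_abs_sub ((n : ℤ) * q) D
      rw [abs_sub_comm] at h5
      linarith
  rw [Int.abs_eq_natAbs] at h2
  exact_mod_cast h2

lemma IsBiLaplacianField.integral_iSup_ge_of_bump [IsProbabilityMeasure P]
    (h : IsBiLaplacianField η P) (hd : 1 ≤ d) (ψ : Torus d n → ℝ) {R : ℕ} (hR : 1 ≤ R) {τ : ℝ}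
    (h0 : ψ 0 = 1) (hψ : ∀ x, R ≤ rad x → ψ x = 0) (hlap : ∀ x, R ≤ rad x → lap ψ x = 0)
    (hτ : ∑ x, lap ψ x ^ 2 ≤ τ) (hM : 36 ≤ Real.log (n / (2 * R) : ℕ)) :
    (√τ)⁻¹ * (1 / 4 * √(Real.log (n / (2 * R) : ℕ))) ≤ ∫ ω, ⨆ x, η x ω ∂P := by
  set M := n / (2 * R) with hMdef
  have hM2 : 2 ≤ M := by
    by_contra hlt
    have hM1 : (M : ℝ) ≤ 1 := by
      have : M ≤ 1 := by omega
      exact_mod_cast this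
    have := Real.log_nonpos (Nat.cast_nonneg M) hM1
    linarith
  have hRM : 2 * R * M ≤ n := Nat.mul_div_le n (2 * R)
  have : Nonempty (Fin M) := ⟨⟨0, by omega⟩⟩
  let x : Fin M → Torus d n := fun k => Pi.single ⟨0, hd⟩ ((2 * R * k : ℕ) : ZMod n)
  have hx : ∀ k l, k ≠ l → 2 * R ≤ rad (x k - x l) := fun k l hkl =>
    le_rad_sub_of_ne hd hRM k.2 l.2 fun hv => hkl (Fin.ext hv)
  have hdisj : ∀ k l, k ≠ l → ∀ z, lap ψ (z - x k) * lap ψ (z - x l) = 0 := by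
    intro k l hkl z
    by_contra hne
    have h1 : rad (z - x k) < R := by
      by_contra hlt
      exact hne (by rw [hlap _ (not_lt.1 hlt), zero_mul])
    have h2 : rad (z - x l) < R := by
      by_contra hlt
      exact hne (by rw [hlap _ (not_lt.1 hlt), mul_zero])
    have h3 := rad_add_le (-(z - x k)) (z - x l)
    rw [rad_neg, show -(z - x k) + (z - x l) = x k - x l by abel] at h3
    have := hx k l hkl
    omega
  have hshift : ∀ k, ∑ z, lap ψ (z - x k) * lap ψ (z - x k) = ∑ z, lap ψ z ^ 2 := fun k =>
    Fintype.sum_equiv (Equiv.subRight (x k)) _ _ fun z => by simp [pow_two]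
  -- Zero energy would make ψ constant, while ψ is 1 at the origin and 0 at the difference of two
  -- centres.
  have hpos : 0 < ∑ z, lap ψ z ^ 2 := by
    refine lt_of_le_of_ne (Finset.sum_nonneg fun z _ => sq_nonneg _) fun heq => ?_
    rw [eq_comm, Finset.sum_eq_zero_iff_of_nonneg fun z _ => sq_nonneg _] at heq
    have h1 := eq_of_lap_eq_zero hd (f := ψ)
      (fun z => by simpa using heq z (Finset.mem_univ z)) 0 (x ⟨1, hM2⟩ - x ⟨0, by omega⟩)
    have h2 := hx ⟨1, hM2⟩ ⟨0, by omega⟩ (by simp)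
    rw [h0, hψ _ (by omega)] at h1
    exact one_ne_zero h1
  have key := h.integral_iSup_ge_of_bumps (fun k z => ψ (z - x k)) x hpos (fun k l => ?_)
    (fun k l => ?_) (by simpa using hM)
  · rw [Fintype.card_fin] at key
    refine le_trans ?_ key
    gcongr
  · simp only [lap_comp_sub]
    split_ifs with hkl
    · subst hkl; exact hshift k
    · exact Finset.sum_eq_zero fun z _ => hdisj k l hkl z
  · split_ifs with hkl
    · subst hkl; simpa using h0
    · exact hψ _ (by have := hx l k (Ne.symm hkl); omega)

end Lower

/-! ### The bumps: a point mass for d ≥ 5, a logarithmic cut-off for d = 4. -/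

section Bump

variable {d n : ℕ}

lemma rad_unitStep_le [NeZero n] (a : Fin d × Bool) : rad (unitStep a : Torus d n) ≤ 1 := by
  have h1 : ((1 : ZMod n)).valMinAbs.natAbs ≤ 1 := by
    rw [ZMod.valMinAbs_natAbs_eq_min, ZMod.val_one_eq_one_mod]
    exact (min_le_left _ _).trans (Nat.mod_le 1 n)
  have h2 : rad (Pi.single a.1 1 : Torus d n) ≤ 1 := by
    refine Finset.sup_le fun j _ => ?_
    by_cases hj : j = a.1
    · subst hj; simpa using h1
    · simp [Pi.single_eq_of_ne hj]
  unfold unitStep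
  split_ifs
  · exact h2
  · rw [rad_neg]; exact h2

lemma lap_eq_zero_of_le_rad [NeZero n] {f : Torus d n → ℝ} {R : ℕ} (hf : ∀ x, R ≤ rad x → f x = 0)
    (x : Torus d n) (hx : R + 1 ≤ rad x) : lap f x = 0 := by
  rw [lap, Finset.sum_eq_zero, mul_zero]
  intro a _
  have h1 := rad_add_le (x + unitStep a) (-unitStep a)
  rw [rad_neg, add_neg_cancel_right] at h1
  have h2 := rad_unitStep_le (n := n) a
  rw [hf x (by omega), hf _ (by omega), sub_zero]

lemma abs_lap_le (hd : 1 ≤ d) {f : Torus d n → ℝ} {B : ℝ} (hf : ∀ x, |f x| ≤ B) (x : Torus d n) :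
    |lap f x| ≤ 2 * B := by
  have hd' : (0 : ℝ) < d := by exact_mod_cast hd
  rw [lap, abs_mul, abs_of_pos (by positivity)]
  have h1 : |∑ a : Fin d × Bool, (f (x + unitStep a) - f x)| ≤ 2 * d * (2 * B) := by
    refine (Finset.abs_sum_le_sum_abs _ _).trans ?_
    calc _ ≤ ∑ _a : Fin d × Bool, (B + B) := by
          refine Finset.sum_le_sum fun a _ => (abs_sub _ _).trans ?_
          exact add_le_add (hf _) (hf _)
      _ = _ := by simp; ring
  calc _ ≤ 1 / (2 * (d : ℝ)) * (2 * d * (2 * B)) := by gcongr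
    _ = _ := by field_simp

/-- The energy equals Δ²δ(0), and Δ has sup-norm at most 2. -/
lemma sum_lap_delta_sq_le [NeZero n] (hd : 1 ≤ d) :
    ∑ x, lap (fun y : Torus d n => if y = 0 then 1 else 0) x ^ 2 ≤ 4 := by
  set δ : Torus d n → ℝ := fun y => if y = 0 then 1 else 0 with hδ
  have h1 : ∑ x, lap δ x ^ 2 = lap (lap δ) 0 := by
    simp only [pow_two]
    rw [sum_lap_mul]
    simp [hδ]
  have h2 : ∀ x, |δ x| ≤ 1 := fun x => by
    simp only [hδ]; split_ifs <;> simp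
  rw [h1]
  refine (le_abs_self _).trans ?_
  have := abs_lap_le hd (abs_lap_le hd h2) 0
  linarith

/-- First-order expansion of log at a with a two-sided remainder, from log y ≤ y - 1 at b/a and at
a/b. -/
lemma sub_sub_log_nonneg {a b : ℝ} (ha : 0 < a) (hb : 0 < b) :
    0 ≤ (b - a) / a - (Real.log b - Real.log a) ∧
      (b - a) / a - (Real.log b - Real.log a) ≤ (b - a) ^ 2 / (a * b) := by
  have h1 := Real.log_le_sub_one_of_pos (div_pos hb ha)
  have h2 := Real.log_le_sub_one_of_pos (div_pos ha hb)
  rw [Real.log_div hb.ne' ha.ne'] at h1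
  rw [Real.log_div ha.ne' hb.ne'] at h2
  have h3 : (b - a) / a = b / a - 1 := by field_simp
  have h4 : (b - a) ^ 2 / (a * b) = b / a - 1 + (a / b - 1) := by field_simp; ring
  constructor <;> linarith

lemma log_sub_log_sq_le {a b : ℝ} (ha : 0 < a) (hb : a ≤ 3 * b) (hab : (b - a) ^ 2 ≤ 4 * a) :
    (Real.log b - Real.log a) ^ 2 ≤ 36 / a := by
  have hb0 : 0 < b := by linarith
  have h1 := (sub_sub_log_nonneg ha hb0).1
  have h2 := (sub_sub_log_nonneg hb0 ha).1
  have h3 : (b - a) / a ≤ 3 * |b - a| / a := by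
    gcongr; linarith [le_abs_self (b - a), abs_nonneg (b - a)]
  have h4 : (a - b) / b ≤ 3 * |b - a| / a := by
    rw [div_le_div_iff₀ hb0 ha]
    have h5 : a - b ≤ |b - a| := by rw [abs_sub_comm]; exact le_abs_self _
    calc (a - b) * a ≤ |b - a| * a := by gcongr
      _ ≤ |b - a| * (3 * b) := by gcongr
      _ = _ := by ring
  have h5 : |Real.log b - Real.log a| ≤ 3 * |b - a| / a := by
    rw [abs_le]; constructor <;> linarith
  calc (Real.log b - Real.log a) ^ 2 = |Real.log b - Real.log a| ^ 2 := (sq_abs _).symm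
    _ ≤ (3 * |b - a| / a) ^ 2 := by gcongr
    _ = 9 * (b - a) ^ 2 / a ^ 2 := by rw [div_pow, mul_pow, sq_abs]; norm_num
    _ ≤ 9 * (4 * a) / a ^ 2 := by gcongr
    _ = 36 / a := by field_simp; norm_num

/-- A logarithmic cut-off with Lipschitz derivative: `1` at `q = 1` and `0` for `q ≥ exp l`. -/
noncomputable def logCutoff (l q : ℝ) : ℝ := max (1 - Real.log q / l) 0 ^ 2

/-- The positive part is squared in `logCutoff` for this Taylor bound: u ↦ (u⁺)² has a Lipschitz
derivative, so the edge of the support costs nothing extra. -/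
lemma max_sq_second_order (u v : ℝ) :
    0 ≤ max v 0 ^ 2 - max u 0 ^ 2 - 2 * max u 0 * (v - u) ∧
      max v 0 ^ 2 - max u 0 ^ 2 - 2 * max u 0 * (v - u) ≤ (v - u) ^ 2 := by
  rcases le_total u 0 with hu | hu <;> rcases le_total v 0 with hv | hv <;>
    simp only [max_eq_left, max_eq_right, hu, hv] <;> constructor <;> nlinarith [sq_nonneg (v - u)]

/-- Chain rule for second differences. The second difference of log q is at most (1 + 12 + 12)/a,
and enters with a factor at most 2/l; the two quadratic remainders are at most 36/(a l²) ≤ 36/(a l).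
Hence 122 = 2·25 + 36 + 36. -/
lemma abs_logCutoff_second_difference_le {l a b c : ℝ} (hl : 1 ≤ l) (ha : 1 ≤ a)
    (hb : a ≤ 3 * b) (hc : a ≤ 3 * c) (hab : (b - a) ^ 2 ≤ 4 * a) (hac : (c - a) ^ 2 ≤ 4 * a)
    (habc : |b + c - 2 * a| ≤ 1) :
    |logCutoff l b + logCutoff l c - 2 * logCutoff l a| ≤ 122 / (a * l) := by
  have ha0 : 0 < a := by linarith
  have hb0 : 0 < b := by linarith
  have hc0 : 0 < c := by linarith
  have hl0 : 0 < l := by linarith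
  set ua := 1 - Real.log a / l with hua
  set ub := 1 - Real.log b / l with hub
  set uc := 1 - Real.log c / l with huc
  have hA1 : max ua 0 ≤ 1 := by
    refine max_le ?_ zero_le_one
    have : 0 ≤ Real.log a / l := div_nonneg (Real.log_nonneg ha) hl0.le
    linarith
  have hA0 : 0 ≤ max ua 0 := le_max_right _ _
  obtain ⟨eb0, eb1⟩ := max_sq_second_order ua ub
  obtain ⟨ec0, ec1⟩ := max_sq_second_order ua uc
  have hsq : ∀ t, a ≤ 3 * t → (t - a) ^ 2 ≤ 4 * a →
      (1 - Real.log t / l - ua) ^ 2 ≤ 36 / (a * l) := by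
    intro t ht hta
    have h1 := log_sub_log_sq_le ha0 ht hta
    have h2 : 1 - Real.log t / l - ua = -(Real.log t - Real.log a) / l := by
      rw [hua]; ring
    rw [h2, div_pow, neg_sq]
    calc _ ≤ (36 / a) / l ^ 2 := by gcongr
      _ ≤ (36 / a) / l := by gcongr; nlinarith
      _ = _ := by rw [div_div]
  have hbs := hsq b hb hab
  have hcs := hsq c hc hac
  rw [← hub] at hbs
  rw [← huc] at hcs
  have hrem : ∀ t, a ≤ 3 * t → (t - a) ^ 2 ≤ 4 * a → (t - a) ^ 2 / (a * t) ≤ 12 / a := by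
    intro t ht hta
    have ht0 : 0 < t := by linarith
    rw [div_le_div_iff₀ (by positivity) ha0]
    calc (t - a) ^ 2 * a ≤ (4 * a) * a := by gcongr
      _ ≤ (4 * a) * (3 * t) := by gcongr
      _ = _ := by ring
  obtain ⟨rb0, rb1⟩ := sub_sub_log_nonneg ha0 hb0
  obtain ⟨rc0, rc1⟩ := sub_sub_log_nonneg ha0 hc0
  have hlin : |ub + uc - 2 * ua| ≤ 25 / (a * l) := by
    have h1 : ub + uc - 2 * ua =
        (-((Real.log b - Real.log a) + (Real.log c - Real.log a))) / l := by
      rw [hua, hub, huc]; ring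
    rw [h1, abs_div, abs_of_pos hl0, abs_neg, ← div_div]
    gcongr
    have h2 : |(b - a) / a + (c - a) / a| ≤ 1 / a := by
      rw [← add_div, abs_div, abs_of_pos ha0]
      gcongr
      rwa [show b - a + (c - a) = b + c - 2 * a by ring]
    have h3 := hrem b hb hab
    have h4 := hrem c hc hac
    have h5 : 25 / a = 1 / a + (12 / a + 12 / a) := by ring
    rw [abs_le] at h2 ⊢
    have h6 : 0 ≤ 1 / a := by positivity
    have h7 : 0 ≤ 12 / a := by positivity
    constructor <;> linarith
  have h1 : logCutoff l b + logCutoff l c - 2 * logCutoff l a =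
      2 * max ua 0 * (ub + uc - 2 * ua) +
      ((max ub 0 ^ 2 - max ua 0 ^ 2 - 2 * max ua 0 * (ub - ua)) +
        (max uc 0 ^ 2 - max ua 0 ^ 2 - 2 * max ua 0 * (uc - ua))) := by
    simp only [logCutoff, ← hua, ← hub, ← huc]; ring
  rw [h1]
  refine (abs_add_le _ _).trans ?_
  have h2 : |2 * max ua 0 * (ub + uc - 2 * ua)| ≤ 2 * 1 * (25 / (a * l)) := by
    rw [abs_mul, abs_mul, abs_two, abs_of_nonneg hA0]
    gcongr
  have h3 : 122 / (a * l) = 2 * 1 * (25 / (a * l)) + (36 / (a * l) + 36 / (a * l)) := by ring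
  rw [h3]
  refine add_le_add h2 ?_
  rw [abs_of_nonneg (by linarith)]
  linarith

variable [NeZero n]

/-- A smooth periodic version of `1 + |x|²`. -/
noncomputable def softSq (x : Torus d n) : ℝ :=
  1 + ((n : ℝ) / (2 * Real.pi)) ^ 2 * ∑ i, (1 - (ZMod.stdAddChar (x i) : ℂ).re)

lemma one_sub_re_stdAddChar_nonneg (k : ZMod n) : 0 ≤ 1 - (ZMod.stdAddChar k : ℂ).re :=
  le_trans (by positivity) (one_sub_re_stdAddChar_ge k)

lemma one_le_softSq (x : Torus d n) : 1 ≤ softSq x := by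
  have : 0 ≤ ((n : ℝ) / (2 * Real.pi)) ^ 2 * ∑ i, (1 - (ZMod.stdAddChar (x i) : ℂ).re) :=
    mul_nonneg (by positivity) (Finset.sum_nonneg fun i _ => one_sub_re_stdAddChar_nonneg _)
  rw [softSq]; linarith

lemma softSq_zero : softSq (0 : Torus d n) = 1 := by simp [softSq]

/-- The squared distance is the symbol read in position space, so the frequency estimates for `symb`
apply to `softSq`. -/
lemma softSq_eq (hd : 1 ≤ d) (x : Torus d n) :
    softSq x = 1 + ((n : ℝ) / (2 * Real.pi)) ^ 2 * (d * symb x) := by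
  have hd' : (d : ℝ) ≠ 0 := by positivity
  rw [softSq, symb]
  congr 2
  field_simp

lemma rad_sq_le_softSq (hd : 1 ≤ d) (x : Torus d n) : (rad x : ℝ) ^ 2 ≤ 5 * softSq x := by
  have hn : (0 : ℝ) < n := by exact_mod_cast NeZero.pos n
  have hd' : (0 : ℝ) < d := by exact_mod_cast hd
  have h1 := symb_ge hd x
  have h2 : ((n : ℝ) / (2 * Real.pi)) ^ 2 * (d * (8 / d * ((rad x : ℝ) / n) ^ 2)) ≤
      ((n : ℝ) / (2 * Real.pi)) ^ 2 * (d * symb x) := by gcongr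
  have h3 : ((n : ℝ) / (2 * Real.pi)) ^ 2 * (d * (8 / d * ((rad x : ℝ) / n) ^ 2)) =
      2 * (rad x : ℝ) ^ 2 / Real.pi ^ 2 := by
    field_simp; norm_num
  rw [h3, div_le_iff₀ (by positivity)] at h2
  have h4 : Real.pi ^ 2 ≤ 10 := by nlinarith [Real.pi_lt_d2, Real.pi_pos]
  set y := ((n : ℝ) / (2 * Real.pi)) ^ 2 * (d * symb x)
  have h5 : 0 ≤ y := mul_nonneg (by positivity) (mul_nonneg hd'.le (symb_nonneg hd x))
  rw [softSq_eq hd]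
  nlinarith

lemma softSq_add_unitStep (x : Torus d n) (i : Fin d) (b : Bool) :
    softSq (x + unitStep (i, b)) - softSq x = ((n : ℝ) / (2 * Real.pi)) ^ 2 *
      ((ZMod.stdAddChar (x i) : ℂ).re -
        (ZMod.stdAddChar (x i + if b then 1 else -1) : ℂ).re) := by
  have h1 : ∀ j, (1 - (ZMod.stdAddChar ((x + unitStep (i, b) : Torus d n) j) : ℂ).re) -
      (1 - (ZMod.stdAddChar (x j) : ℂ).re) =
      if j = i then (ZMod.stdAddChar (x i) : ℂ).re -
        (ZMod.stdAddChar (x i + if b then 1 else -1) : ℂ).re else 0 := by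
    intro j
    split_ifs with hj hb
    · subst hj; simp [unitStep, hb]
    · subst hj; simp [unitStep, hb]
    · have : (unitStep (i, b) : Torus d n) j = 0 := by
        unfold unitStep; split_ifs <;> simp [hj]
      simp [this]
  have h2 : ∑ j, (1 - (ZMod.stdAddChar ((x + unitStep (i, b) : Torus d n) j) : ℂ).re) -
      ∑ j, (1 - (ZMod.stdAddChar (x j) : ℂ).re) = (ZMod.stdAddChar (x i) : ℂ).re -
        (ZMod.stdAddChar (x i + if b then 1 else -1) : ℂ).re := by
    rw [← Finset.sum_sub_distrib, Finset.sum_congr rfl fun j _ => h1 j]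
    simp
  rw [softSq, softSq, ← h2]; ring

/-- Discrete form of |∇q|² ≤ 4q. With δ = 2π/n, the main term sin α sin θ is controlled by sin² α ≤
2(1 - cos α) ≤ 2δ²(q - 1). -/
lemma softSq_step_sq_le (x : Torus d n) (i : Fin d) (b : Bool) :
    (softSq (x + unitStep (i, b)) - softSq x) ^ 2 ≤ 4 * softSq x := by
  have hn : (0 : ℝ) < n := by exact_mod_cast NeZero.pos n
  set δ : ℝ := 2 * Real.pi / n with hδ
  have hδ0 : 0 < δ := by positivity
  have hK : ((n : ℝ) / (2 * Real.pi)) ^ 2 = 1 / δ ^ 2 := by rw [hδ]; field_simp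
  obtain ⟨k, hk⟩ := ZMod.intCast_surjective (x i)
  set α : ℝ := 2 * Real.pi * k / n with hα
  have hx : (ZMod.stdAddChar (x i) : ℂ).re = Real.cos α := by rw [← hk, re_stdAddChar_intCast]
  have hq : 1 - Real.cos α ≤ δ ^ 2 * (softSq x - 1) := by
    have h1 : 1 - (ZMod.stdAddChar (x i) : ℂ).re ≤ ∑ j, (1 - (ZMod.stdAddChar (x j) : ℂ).re) :=
      Finset.single_le_sum (f := fun j => 1 - (ZMod.stdAddChar (x j) : ℂ).re)
        (fun j _ => one_sub_re_stdAddChar_nonneg _) (Finset.mem_univ i)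
    rw [softSq, hK, add_sub_cancel_left, ← mul_assoc, mul_one_div_cancel (by positivity), one_mul,
      ← hx]
    exact h1
  obtain ⟨θ, hθ, hstep⟩ : ∃ θ : ℝ, |θ| = δ ∧
      (ZMod.stdAddChar (x i + if b then 1 else -1) : ℂ).re = Real.cos (α + θ) := by
    cases b
    · refine ⟨-δ, by rw [abs_neg, abs_of_pos hδ0], ?_⟩
      have h1 : x i + (if false = true then 1 else -1) = ((k + -1 : ℤ) : ZMod n) := by
        rw [← hk]; push_cast; simp
      rw [h1, re_stdAddChar_intCast]
      congr 1
      rw [hα, hδ]; push_cast; ring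
    · refine ⟨δ, abs_of_pos hδ0, ?_⟩
      have h1 : x i + (if true = true then 1 else -1) = ((k + 1 : ℤ) : ZMod n) := by
        rw [← hk]; push_cast; simp
      rw [h1, re_stdAddChar_intCast]
      congr 1
      rw [hα, hδ]; push_cast; ring
  rw [softSq_add_unitStep, hx, hstep, hK, mul_pow, div_pow, one_pow, div_mul_eq_mul_div, one_mul,
    div_le_iff₀ (by positivity)]
  have hθ2 : θ ^ 2 = δ ^ 2 := by rw [← sq_abs, hθ]
  have hc1 : 1 - Real.cos θ ≤ δ ^ 2 / 2 := by
    have := Real.one_sub_sq_div_two_le_cos (x := θ)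
    rw [hθ2] at this; linarith
  have hc0 : 0 ≤ 1 - Real.cos θ := by linarith [Real.cos_le_one θ]
  have hs : Real.sin θ ^ 2 ≤ δ ^ 2 := by
    rw [← hθ2]; exact Real.sin_sq_le_sq
  have hsα : Real.sin α ^ 2 ≤ 2 * (1 - Real.cos α) := by
    rw [Real.sin_sq]; nlinarith [sq_nonneg (1 - Real.cos α)]
  have hcα : Real.cos α ^ 2 ≤ 1 := Real.cos_sq_le_one α
  rw [Real.cos_add]
  have hexp : Real.cos α - (Real.cos α * Real.cos θ - Real.sin α * Real.sin θ) =
      Real.cos α * (1 - Real.cos θ) + Real.sin α * Real.sin θ := by ring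
  rw [hexp]
  have h1 : (Real.cos α * (1 - Real.cos θ)) ^ 2 ≤ (δ ^ 2 / 2) ^ 2 := by
    rw [mul_pow]
    calc Real.cos α ^ 2 * (1 - Real.cos θ) ^ 2 ≤ 1 * (δ ^ 2 / 2) ^ 2 := by gcongr
      _ = _ := one_mul _
  have h2 : (Real.sin α * Real.sin θ) ^ 2 ≤ 2 * (δ ^ 2 * (softSq x - 1)) * δ ^ 2 := by
    have := one_le_softSq x
    rw [mul_pow]
    exact mul_le_mul (by linarith) hs (sq_nonneg _)
      (mul_nonneg zero_le_two (mul_nonneg (sq_nonneg δ) (by linarith)))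
  have h3 : (Real.cos α * (1 - Real.cos θ) + Real.sin α * Real.sin θ) ^ 2 ≤
      2 * (Real.cos α * (1 - Real.cos θ)) ^ 2 + 2 * (Real.sin α * Real.sin θ) ^ 2 := by
    nlinarith [sq_nonneg (Real.cos α * (1 - Real.cos θ) - Real.sin α * Real.sin θ)]
  have h4 : 0 ≤ (δ ^ 2) ^ 2 := by positivity
  nlinarith

lemma abs_softSq_second_difference_le (x : Torus d n) (i : Fin d) :
    |softSq (x + unitStep (i, true)) + softSq (x + unitStep (i, false)) - 2 * softSq x| ≤ 1 := by
  have hn : (0 : ℝ) < n := by exact_mod_cast NeZero.pos n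
  have h1 := softSq_add_unitStep x i true
  have h2 := softSq_add_unitStep x i false
  have h3 := re_stdAddChar_add_add_sub (x i) 1
  simp only [if_true, Bool.false_eq_true, if_false, ← sub_eq_add_neg] at h1 h2
  have h4 : softSq (x + unitStep (i, true)) + softSq (x + unitStep (i, false)) - 2 * softSq x =
      ((n : ℝ) / (2 * Real.pi)) ^ 2 * (2 * (ZMod.stdAddChar (x i) : ℂ).re *
        (1 - (ZMod.stdAddChar (1 : ZMod n) : ℂ).re)) := by
    linear_combination h1 + h2 - ((n : ℝ) / (2 * Real.pi)) ^ 2 * h3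
  have h5 : 1 - (ZMod.stdAddChar (1 : ZMod n) : ℂ).re ≤ (2 * Real.pi / n) ^ 2 / 2 := by
    have h6 := re_stdAddChar_intCast (n := n) 1
    rw [Int.cast_one, Int.cast_one, mul_one] at h6
    rw [h6]
    have := Real.one_sub_sq_div_two_le_cos (x := 2 * Real.pi / n)
    linarith
  have h6 := one_sub_re_stdAddChar_nonneg (1 : ZMod n)
  have h7 : |(ZMod.stdAddChar (x i) : ℂ).re| ≤ 1 := by
    obtain ⟨k, hk⟩ := ZMod.intCast_surjective (x i)
    rw [← hk, re_stdAddChar_intCast]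
    exact Real.abs_cos_le_one _
  rw [h4, abs_mul, abs_mul, abs_mul, abs_two, abs_of_nonneg h6,
    abs_of_nonneg (sq_nonneg ((n : ℝ) / (2 * Real.pi)))]
  calc _ ≤ ((n : ℝ) / (2 * Real.pi)) ^ 2 * (2 * 1 * ((2 * Real.pi / n) ^ 2 / 2)) := by gcongr
    _ = 1 := by field_simp

lemma softSq_le_three_mul (x : Torus d n) (i : Fin d) (b : Bool) :
    softSq x ≤ 3 * softSq (x + unitStep (i, b)) := by
  have h1 := softSq_step_sq_le (x + unitStep (i, b)) i (!b)
  rw [unitStep_not, add_neg_cancel_right] at h1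
  have h2 := one_le_softSq (x + unitStep (i, b))
  nlinarith

lemma abs_lap_logCutoff_le (hd : 1 ≤ d) {l : ℝ} (hl : 1 ≤ l) (x : Torus d n) :
    |lap (fun y => logCutoff l (softSq y)) x| ≤ 61 / (softSq x * l) := by
  have hd' : (0 : ℝ) < d := by exact_mod_cast hd
  rw [lap, abs_mul, abs_of_pos (by positivity : 0 < 1 / (2 * (d : ℝ)))]
  have h1 : |∑ a : Fin d × Bool, (logCutoff l (softSq (x + unitStep a)) -
      logCutoff l (softSq x))| ≤ d * (122 / (softSq x * l)) := by
    simp only [Fintype.sum_prod_type, Fintype.sum_bool]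
    refine (Finset.abs_sum_le_sum_abs _ _).trans ?_
    calc _ ≤ ∑ _i : Fin d, 122 / (softSq x * l) := by
          refine Finset.sum_le_sum fun i _ => ?_
          have := abs_logCutoff_second_difference_le hl (one_le_softSq x)
            (softSq_le_three_mul x i true) (softSq_le_three_mul x i false)
            (softSq_step_sq_le x i true) (softSq_step_sq_le x i false)
            (abs_softSq_second_difference_le x i)
          refine le_trans (le_of_eq (congrArg abs ?_)) this
          ring
      _ = _ := by simp
  calc _ ≤ 1 / (2 * (d : ℝ)) * (d * (122 / (softSq x * l))) := by gcongr
    _ = _ := by field_simp; norm_num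

/-- Away from the origin this is the symbol sum in dimension four; the origin contributes 1,
absorbed by log n. -/
lemma sum_inv_softSq_sq_le (hn : 2 ≤ n) (hl : 1 ≤ Real.log n) :
    ∑ x : Torus 4 n, (softSq x ^ 2)⁻¹ ≤ 2000000 * Real.log n := by
  have hn' : (0 : ℝ) < n := by positivity
  rw [← Finset.add_sum_erase _ _ (Finset.mem_univ (0 : Torus 4 n)), softSq_zero]
  have h1 : ∀ x ∈ Finset.univ.erase (0 : Torus 4 n),
      (softSq x ^ 2)⁻¹ ≤ Real.pi ^ 4 / n ^ 4 * (symb x ^ 2)⁻¹ := by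
    intro x hx
    have hs := symb_pos (by norm_num : 1 ≤ 4) (Finset.ne_of_mem_erase hx)
    have h2 : ((n : ℝ) / Real.pi) ^ 2 * symb x ≤ softSq x := by
      rw [softSq_eq (by norm_num)]
      have h3 : ((n : ℝ) / (2 * Real.pi)) ^ 2 * (((4 : ℕ) : ℝ) * symb x) =
          ((n : ℝ) / Real.pi) ^ 2 * symb x := by
        push_cast; field_simp; norm_num
      linarith
    calc (softSq x ^ 2)⁻¹ ≤ ((((n : ℝ) / Real.pi) ^ 2 * symb x) ^ 2)⁻¹ := by gcongr
      _ = _ := by field_simp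
  have h2 := Finset.sum_le_sum h1
  rw [← Finset.mul_sum] at h2
  have h3 := sum_inv_symb_sq_le_four hn
  have h4 : Real.pi ^ 4 ≤ 100 := by
    have : Real.pi ^ 2 ≤ 10 := by nlinarith [Real.pi_lt_d2, Real.pi_pos]
    calc Real.pi ^ 4 = (Real.pi ^ 2) ^ 2 := by ring
      _ ≤ 10 ^ 2 := by gcongr
      _ = 100 := by norm_num
  have h5 : Real.pi ^ 4 / n ^ 4 * ∑ x ∈ Finset.univ.erase (0 : Torus 4 n), (symb x ^ 2)⁻¹ ≤
      1638400 * Real.log n := by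
    calc _ ≤ 100 / (n : ℝ) ^ 4 * (16384 * (n : ℝ) ^ 4 * Real.log n) := by gcongr
      _ = _ := by field_simp; norm_num
  rw [one_pow, inv_one]
  linarith

/-- The cut-off with parameter log n vanishes once `softSq` ≥ n, that is, beyond a radius of order
√n. -/
lemma logCutoff_softSq_eq_zero (hd : 1 ≤ d) (hl : 0 < Real.log n) {x : Torus d n}
    (hx : 3 * (Nat.sqrt n + 1) ≤ rad x) : logCutoff (Real.log n) (softSq x) = 0 := by
  have h1 := rad_sq_le_softSq hd x
  have h2 : n < (Nat.sqrt n + 1) * (Nat.sqrt n + 1) := Nat.lt_succ_sqrt n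
  have h3 : 5 * n ≤ rad x ^ 2 := by nlinarith
  have h4 : (5 * n : ℝ) ≤ (rad x : ℝ) ^ 2 := by exact_mod_cast h3
  have h5 : Real.log n ≤ Real.log (softSq x) :=
    Real.log_le_log (by exact_mod_cast NeZero.pos n) (by linarith)
  have h6 : 1 ≤ Real.log (softSq x) / Real.log n := by rwa [one_le_div hl]
  rw [logCutoff, max_eq_right (by linarith)]
  norm_num

variable {Ω : Type*} [MeasurableSpace Ω] {P : Measure Ω} [IsProbabilityMeasure P]
  {η : Torus d n → Ω → ℝ}

lemma IsBiLaplacianField.integral_iSup_ge_sqrt_log (h : IsBiLaplacianField η P) (hd : 1 ≤ d)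
    (hM : n ≤ (n / 4) ^ 4) (hn : 144 ≤ Real.log n) :
    1 / 16 * √(Real.log n) ≤ ∫ ω, ⨆ x, η x ω ∂P := by
  have hlog : Real.log n / 4 ≤ Real.log (n / (2 * 2) : ℕ) := by
    have h1 : Real.log n ≤ Real.log ((n / 4 : ℕ) ^ 4 : ℕ) :=
      Real.log_le_log (by exact_mod_cast NeZero.pos n) (by exact_mod_cast hM)
    rw [Nat.cast_pow, Real.log_pow] at h1
    norm_num at h1 ⊢
    linarith
  -- R = 2 because the Laplacian of the point mass reaches radius 1; 144 = 4 · 36 supplies the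
  -- required log M ≥ 36.
  have key := h.integral_iSup_ge_of_bump hd (fun y => if y = 0 then 1 else 0) (R := 2)
    (by norm_num) (by simp) (fun x hx => if_neg fun h0 => by simp [rad_eq_zero.2 h0] at hx)
    (lap_eq_zero_of_le_rad (R := 1) fun x hx => if_neg fun h0 => by simp [rad_eq_zero.2 h0] at hx)
    (sum_lap_delta_sq_le hd) (by linarith)
  refine le_trans ?_ key
  have h4 : √(4 : ℝ) = 2 := by
    rw [show (4 : ℝ) = 2 ^ 2 by norm_num]; exact Real.sqrt_sq (by norm_num)
  have h5 : √(Real.log n) / 2 ≤ √(Real.log (n / (2 * 2) : ℕ)) := by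
    rw [← h4, ← Real.sqrt_div' _ (by norm_num)]
    exact Real.sqrt_le_sqrt hlog
  rw [h4]
  linarith

lemma IsBiLaplacianField.integral_iSup_ge_log {η : Torus 4 n → Ω → ℝ}
    (h : IsBiLaplacianField η P)
    (hM : n ≤ (n / (2 * (3 * (Nat.sqrt n + 1) + 1))) ^ 4) (hn : 144 ≤ Real.log n) :
    1 / 800000 * Real.log n ≤ ∫ ω, ⨆ x, η x ω ∂P := by
  set l := Real.log n with hl
  have hl0 : 0 < l := by linarith
  have hn2 : 2 ≤ n := by
    by_contra hlt
    have h1 : (n : ℝ) ≤ 1 := by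
      have : n ≤ 1 := by omega
      exact_mod_cast this
    have := Real.log_nonpos (Nat.cast_nonneg n) h1
    linarith
  set R := 3 * (Nat.sqrt n + 1) + 1 with hR
  have hlog : l / 4 ≤ Real.log (n / (2 * R) : ℕ) := by
    have h1 : Real.log n ≤ Real.log ((n / (2 * R) : ℕ) ^ 4 : ℕ) :=
      Real.log_le_log (by exact_mod_cast NeZero.pos n) (by exact_mod_cast hM)
    rw [Nat.cast_pow, Real.log_pow] at h1
    push_cast at h1
    linarith
  -- |Δψ| is of order 1/(l q) and ∑ q^{-2} is of order l, so the energy is of order 1/l. This small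
  -- energy raises √(log n) to log n in dimension four.
  have hτ : ∑ x : Torus 4 n, lap (fun y => logCutoff l (softSq y)) x ^ 2 ≤ 10 ^ 10 / l := by
    calc _ ≤ ∑ x : Torus 4 n, 61 ^ 2 / l ^ 2 * (softSq x ^ 2)⁻¹ := by
          refine Finset.sum_le_sum fun x _ => ?_
          rw [← sq_abs]
          calc _ ≤ (61 / (softSq x * l)) ^ 2 := by
                gcongr
                exact abs_lap_logCutoff_le (by norm_num) (by linarith) x
            _ = _ := by rw [div_pow, mul_pow]; field_simp
      _ = 61 ^ 2 / l ^ 2 * ∑ x : Torus 4 n, (softSq x ^ 2)⁻¹ := by rw [Finset.mul_sum]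
      _ ≤ 61 ^ 2 / l ^ 2 * (2000000 * l) := by
          gcongr
          exact sum_inv_softSq_sq_le hn2 (by linarith)
      _ = 7442000000 / l := by field_simp; norm_num
      _ ≤ _ := by gcongr; norm_num
  have key := h.integral_iSup_ge_of_bump (by norm_num) (fun y => logCutoff l (softSq y)) (R := R)
    (by omega) (by simp [softSq_zero, logCutoff])
    (fun x hx => logCutoff_softSq_eq_zero (by norm_num) hl0 (by omega))
    (lap_eq_zero_of_le_rad fun x hx => logCutoff_softSq_eq_zero (by norm_num) hl0 hx)
    hτ (by linarith)
  refine le_trans ?_ key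
  have h1 : √l / 2 ≤ √(Real.log (n / (2 * R) : ℕ)) := by
    have h4 : √(4 : ℝ) = 2 := by
      rw [show (4 : ℝ) = 2 ^ 2 by norm_num]; exact Real.sqrt_sq (by norm_num)
    rw [← h4, ← Real.sqrt_div' _ (by norm_num)]
    exact Real.sqrt_le_sqrt hlog
  have h2 : (√(10 ^ 10 / l))⁻¹ = √l / 10 ^ 5 := by
    rw [Real.sqrt_div (by norm_num), inv_div, show (10 : ℝ) ^ 10 = (10 ^ 5) ^ 2 by norm_num,
      Real.sqrt_sq (by norm_num)]
  rw [h2]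
  calc 1 / 800000 * l = √l / 10 ^ 5 * (1 / 4 * (√l / 2)) := by
        nlinarith [Real.mul_self_sqrt hl0.le]
    _ ≤ _ := by gcongr

end Bump

/-! ### The odometer of the sandpile in terms of a potential. -/

section Odometer

variable {d n : ℕ}

lemma add_lap_eq (hd : 1 ≤ d) (f : Torus d n → ℝ) (x : Torus d n) :
    f x + lap f x = 1 / (2 * (d : ℝ)) * ∑ a : Fin d × Bool, f (x + unitStep a) := by
  have hd' : (d : ℝ) ≠ 0 := by positivity
  rw [lap, Finset.sum_sub_distrib]
  simp only [Finset.sum_const, Finset.card_univ, Fintype.card_prod, Fintype.card_fin,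
    Fintype.card_bool, nsmul_eq_mul]
  push_cast
  field_simp
  ring

/-- f + Δf is the average over neighbours; this monotonicity drives the least action principle. -/
lemma add_lap_mono (hd : 1 ≤ d) {f g : Torus d n → ℝ} (h : ∀ x, f x ≤ g x) (x : Torus d n) :
    f x + lap f x ≤ g x + lap g x := by
  rw [add_lap_eq hd, add_lap_eq hd]
  gcongr
  exact h _

lemma odometer_succ (s : Torus d n → ℝ) (t : ℕ) (x : Torus d n) :
    odometer s (t + 1) x = odometer s t x + max (config s t x - 1) 0 := by
  rw [odometer, Finset.sum_range_succ]; rfl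

lemma config_eq (s : Torus d n → ℝ) (t : ℕ) (x : Torus d n) :
    config s t x = s x + lap (odometer s t) x := by
  induction t generalizing x with
  | zero =>
    have : odometer s 0 = fun _ => 0 := by ext; simp [odometer]
    rw [this, lap_const, add_zero]; rfl
  | succ t ih =>
    have : odometer s (t + 1) = fun y => odometer s t y + max (config s t y - 1) 0 := by
      ext y; exact odometer_succ s t y
    rw [this, lap_add, ← add_assoc, ← ih]
    rfl

lemma odometer_nonneg (s : Torus d n → ℝ) (t : ℕ) (x : Torus d n) : 0 ≤ odometer s t x :=
  Finset.sum_nonneg fun _ _ => le_max_right _ _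

lemma odometer_mono (s : Torus d n → ℝ) (x : Torus d n) : Monotone fun t => odometer s t x :=
  monotone_nat_of_le_succ fun t => by
    rw [odometer_succ]; exact le_add_of_nonneg_right (le_max_right _ _)

/-- The least action principle: the odometer is below every nonnegative stabilizing function. -/
lemma odometer_le (hd : 1 ≤ d) {s w : Torus d n → ℝ} (hw : ∀ x, 0 ≤ w x)
    (hs : ∀ x, s x + lap w x ≤ 1) (t : ℕ) (x : Torus d n) : odometer s t x ≤ w x := by
  induction t generalizing x with
  | zero => simpa [odometer] using hw x
  | succ t ih =>
    rw [odometer_succ]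
    rcases le_total (config s t x - 1) 0 with h | h
    · rw [max_eq_right h, add_zero]; exact ih x
    · rw [max_eq_left h, config_eq]
      have := add_lap_mono hd ih x
      linarith [hs x]

variable [NeZero n]

/-- w = v - min v is nonnegative and stabilises s, so the odometers are bounded by w and converge to
some u ≤ w. The difference w - u is harmonic, hence constant, and it vanishes where v is minimal. -/
lemma odometerLimit_eq (hd : 1 ≤ d) {s v : Torus d n → ℝ} (hv : ∀ x, s x + lap v x = 1)
    (x : Torus d n) : odometerLimit s x = ENNReal.ofReal (v x - ⨅ y, v y) := by
  obtain ⟨x₀, hx₀⟩ := exists_eq_ciInf_of_finite (f := v)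
  rw [← hx₀]
  set w : Torus d n → ℝ := fun x => v x - v x₀ with hw
  have hw0 : ∀ x, 0 ≤ w x := fun x => by
    have := ciInf_le (Set.finite_range v).bddBelow x
    simp only [hw]; linarith
  have hws : ∀ x, s x + lap w x = 1 := fun x => by
    rw [hw, lap_sub, lap_const, sub_zero, hv]
  have hle := odometer_le hd hw0 fun x => (hws x).le
  have hbdd : ∀ x, BddAbove (Set.range fun t => odometer s t x) := fun x =>
    ⟨w x, by rintro _ ⟨t, rfl⟩; exact hle t x⟩
  set u : Torus d n → ℝ := fun x => ⨆ t, odometer s t x with hu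
  have hlim : ∀ x, Filter.Tendsto (fun t => odometer s t x) Filter.atTop (nhds (u x)) := fun x =>
    tendsto_atTop_ciSup (odometer_mono s x) (hbdd x)
  have hlap : ∀ x, Filter.Tendsto (fun t => lap (odometer s t) x) Filter.atTop
      (nhds (lap u x)) := fun x =>
    (tendsto_finsetSum _ fun a _ => (hlim _).sub (hlim x)).const_mul _
  have hstable : ∀ x, s x + lap u x ≤ 1 := by
    intro x
    -- The excess over 1 at time t is at most the odometer increment, which tends to 0; so the limit
    -- is stable.
    have h1 : Filter.Tendsto (fun t => odometer s (t + 1) x - odometer s t x) Filter.atTop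
        (nhds 0) := by
      simpa using ((Filter.tendsto_add_atTop_iff_nat 1).2 (hlim x)).sub (hlim x)
    have h2 : Filter.Tendsto (fun t => s x + lap (odometer s t) x - 1) Filter.atTop
        (nhds (s x + lap u x - 1)) := ((hlap x).const_add _).sub_const _
    have h3 := le_of_tendsto_of_tendsto' h2 h1 fun t => by
      rw [odometer_succ, add_sub_cancel_left, config_eq]
      exact le_max_left _ _
    linarith
  -- The final heights are at most 1 and sum to the number of sites, hence all equal 1.
  have heq : ∀ x, s x + lap u x = 1 := by
    have h1 : ∑ x, (1 - (s x + lap u x)) = 0 := by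
      have h2 : ∑ x, (s x + lap w x) = ∑ _x : Torus d n, (1 : ℝ) := Finset.sum_congr rfl fun x _ => hws x
      rw [Finset.sum_add_distrib, sum_lap] at h2
      rw [Finset.sum_sub_distrib, Finset.sum_add_distrib, sum_lap, h2, sub_self]
    rw [Finset.sum_eq_zero_iff_of_nonneg fun x _ => sub_nonneg.2 (hstable x)] at h1
    intro x
    linarith [h1 x (Finset.mem_univ x)]
  have hconst := eq_of_lap_eq_zero hd (f := fun x => w x - u x)
    (fun x => by rw [lap_sub]; linarith [heq x, hws x])
  have hx0 : u x₀ = 0 := by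
    refine le_antisymm ?_ (le_ciSup_of_le (hbdd x₀) 0 (odometer_nonneg s 0 x₀))
    refine ciSup_le fun t => (hle t x₀).trans ?_
    simp [hw]
  have huw : u x = w x := by
    have h1 := hconst x x₀
    have h2 : w x₀ = 0 := by simp [hw]
    simp only [hx0, h2] at h1
    linarith
  have h1 : Filter.Tendsto (fun t => ENNReal.ofReal (odometer s t x)) Filter.atTop
      (nhds (odometerLimit s x)) :=
    tendsto_atTop_iSup fun a b hab => ENNReal.ofReal_le_ofReal (odometer_mono s x hab)
  have h2 := ENNReal.tendsto_ofReal (hlim x)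
  rw [tendsto_nhds_unique h1 h2, huw]

end Odometer

/-! ### Green's function of the killed walk; η is a bi-Laplacian field. -/

section Green

variable {d n : ℕ}

lemma walk_snoc_of_le {t : ℕ} (x : Torus d n) (w : Fin t → Fin d × Bool) (a : Fin d × Bool)
    {r : ℕ} (hr : r ≤ t) :
    walk x (Fin.snoc (α := fun _ => Fin d × Bool) w a) r = walk x w r := by
  simp [walk, Fin.sum_univ_castSucc, hr]

lemma walk_snoc_succ {t : ℕ} (x : Torus d n) (w : Fin t → Fin d × Bool) (a : Fin d × Bool) :
    walk x (Fin.snoc (α := fun _ => Fin d × Bool) w a) (t + 1) = walk x w t + unitStep a := by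
  simp [walk, Fin.sum_univ_castSucc, add_assoc]

lemma killedProb_nonneg (z : Torus d n) (t : ℕ) (x y : Torus d n) : 0 ≤ killedProb z t x y := by
  unfold killedProb; positivity

lemma killedProb_self (z : Torus d n) (t : ℕ) (x : Torus d n) : killedProb z t x z = 0 := by
  unfold killedProb
  rw [Finset.card_eq_zero.2, Nat.cast_zero, zero_div]
  rw [Finset.filter_eq_empty_iff]
  exact fun w _ h => h.2 t le_rfl h.1

lemma killedProb_zero {x y z : Torus d n} (hy : y ≠ z) :
    killedProb z 0 x y = if x = y then 1 else 0 := by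
  unfold killedProb
  have h : ∀ w : Fin 0 → Fin d × Bool, ∀ r, walk x w r = x := fun w r => by simp [walk]
  simp only [h, pow_zero, div_one]
  split_ifs with hxy
  · subst hxy; simp [hy]
  · simp [hxy]

/-- Forward equation, by splitting off the last step. It fails at y = z, where the left side is 0 by
killing. -/
lemma killedProb_succ (hd : 1 ≤ d) {z y : Torus d n} (hy : y ≠ z) (t : ℕ) (x : Torus d n) :
    killedProb z (t + 1) x y = killedProb z t x y + lap (killedProb z t x) y := by
  classical
  have hd' : (d : ℝ) ≠ 0 := by positivity
  rw [add_lap_eq hd, ← sum_unitStep_neg fun s => killedProb z t x (y + s)]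
  have hcount : (Finset.card {w : Fin (t + 1) → Fin d × Bool |
        walk x w (t + 1) = y ∧ ∀ r ≤ t + 1, walk x w r ≠ z} : ℝ) =
      ∑ a : Fin d × Bool, (Finset.card {w : Fin t → Fin d × Bool |
        walk x w t = y + -unitStep a ∧ ∀ r ≤ t, walk x w r ≠ z} : ℝ) := by
    simp only [Finset.card_filter]
    push_cast
    rw [← (Fin.snocEquiv fun _ => Fin d × Bool).sum_comp, Fintype.sum_prod_type]
    refine Finset.sum_congr rfl fun a _ => Finset.sum_congr rfl fun w _ => ?_
    have hiff : (walk x (Fin.snoc (α := fun _ => Fin d × Bool) w a) (t + 1) = y ∧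
        ∀ r ≤ t + 1, walk x (Fin.snoc (α := fun _ => Fin d × Bool) w a) r ≠ z) ↔
        (walk x w t = y + -unitStep a ∧ ∀ r ≤ t, walk x w r ≠ z) := by
      rw [walk_snoc_succ, ← sub_eq_add_neg, eq_sub_iff_add_eq]
      refine and_congr_right fun h => ⟨fun H r hr => ?_, fun H r hr => ?_⟩
      · rw [← walk_snoc_of_le x w a hr]; exact H r (by omega)
      · rcases Nat.le_succ_iff.1 hr with hr' | rfl
        · rw [walk_snoc_of_le x w a hr']; exact H r hr'
        · rw [walk_snoc_succ, h]; exact hy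
    exact if_congr hiff rfl rfl
  unfold killedProb
  rw [Finset.mul_sum]
  simp only [← mul_div_assoc, ← Finset.sum_div, ← Finset.mul_sum]
  convert congrArg (fun c : ℝ => c / (2 * (d : ℝ)) ^ (t + 1)) hcount using 1
  rw [pow_succ]
  field_simp

variable [NeZero n]

/-- The witness n^d (G₁(0) - G₁(y - z)), with G₁ = `kern d n 1`, is the mean hitting time of z; it
serves as a Lyapunov function. -/
lemma exists_nonneg_lap_eq (hd : 1 ≤ d) (z : Torus d n) :
    ∃ V : Torus d n → ℝ, (∀ y, 0 ≤ V y) ∧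
      ∀ y, lap V y = -1 + if y = z then (n : ℝ) ^ d else 0 := by
  have hn : (n : ℝ) ≠ 0 := by exact_mod_cast NeZero.ne n
  refine ⟨fun y => -((n : ℝ) ^ d * kern d n 1 (y - z)) + (n : ℝ) ^ d * kern d n 1 0,
    fun y => ?_, fun y => ?_⟩
  · have := kern_le_kern_zero hd 1 (y - z)
    have h2 : (n : ℝ) ^ d * kern d n 1 (y - z) ≤ (n : ℝ) ^ d * kern d n 1 0 := by gcongr
    linarith
  · rw [lap_add_const, lap_neg, lap_const_mul, lap_comp_sub, lap_kern_succ hd, kern_zero]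
    simp only [sub_eq_zero]
    split_ifs <;> field_simp <;> ring

/-- The survival probability at time t is at most the drop of the expectation of V over one step;
these drops telescope and V ≥ 0. -/
lemma summable_killedProb (hd : 1 ≤ d) (z x y : Torus d n) :
    Summable fun t => killedProb z t x y := by
  obtain ⟨V, hV0, hV⟩ := exists_nonneg_lap_eq hd z
  have hstep : ∀ t, ∑ y, killedProb z t x y ≤
      ∑ y, killedProb z t x y * V y - ∑ y, killedProb z (t + 1) x y * V y := by
    intro t
    have h1 : ∑ y, killedProb z (t + 1) x y * V y ≤
        ∑ y, (killedProb z t x y + lap (killedProb z t x) y) * V y := by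
      refine Finset.sum_le_sum fun y _ => mul_le_mul_of_nonneg_right ?_ (hV0 y)
      by_cases hy : y = z
      · subst hy
        rw [killedProb_self, add_lap_eq hd]
        exact mul_nonneg (by positivity) (Finset.sum_nonneg fun a _ => killedProb_nonneg _ _ _ _)
      · exact (killedProb_succ hd hy t x).le
    have h2 : ∑ y, lap (killedProb z t x) y * V y = -∑ y, killedProb z t x y := by
      rw [sum_lap_mul]
      simp [hV, mul_add, Finset.sum_add_distrib, killedProb_self]
    simp only [add_mul, Finset.sum_add_distrib] at h1
    linarith
  have hsum : ∀ T, ∑ t ∈ Finset.range T, killedProb z t x y ≤ ∑ y, killedProb z 0 x y * V y := by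
    intro T
    have h1 : ∀ t, killedProb z t x y ≤ ∑ y, killedProb z t x y := fun t =>
      Finset.single_le_sum (fun y _ => killedProb_nonneg z t x y) (Finset.mem_univ y)
    refine (Finset.sum_le_sum fun t _ => (h1 t).trans (hstep t)).trans ?_
    rw [Finset.sum_range_sub']
    have : 0 ≤ ∑ y, killedProb z T x y * V y :=
      Finset.sum_nonneg fun y _ => mul_nonneg (killedProb_nonneg _ _ _ _) (hV0 y)
    linarith
  exact summable_of_sum_range_le (fun t => killedProb_nonneg z t x y) hsum

/-- Off z, sum the forward equation over time. The value at z is then forced, since a Laplacian sums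
to zero. -/
lemma lap_killedGreen (hd : 1 ≤ d) (z x y : Torus d n) :
    lap (killedGreen z x) y = (if y = z then 1 else 0) - if x = y then 1 else 0 := by
  have hne : ∀ y, y ≠ z → lap (killedGreen z x) y = -if x = y then 1 else 0 := by
    intro y hy
    have hs := summable_killedProb hd z x
    have h1 : killedGreen z x y + lap (killedGreen z x) y =
        ∑' t, (killedProb z t x y + lap (killedProb z t x) y) := by
      have h2 : ∀ t, killedProb z t x y + lap (killedProb z t x) y =
          1 / (2 * (d : ℝ)) * ∑ a : Fin d × Bool, killedProb z t x (y + unitStep a) := fun t =>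
        add_lap_eq hd (killedProb z t x) y
      simp only [h2]
      rw [add_lap_eq hd, tsum_mul_left, Summable.tsum_finsetSum fun a _ => hs _]
      rfl
    have h3 : killedGreen z x y =
        killedProb z 0 x y + ∑' t, killedProb z (t + 1) x y := (hs y).tsum_eq_zero_add
    simp only [killedProb_succ hd hy, killedProb_zero hy] at h3
    rw [← h1] at h3
    linarith
  by_cases hy : y = z
  · subst hy
    have h1 := sum_lap (killedGreen y x)
    rw [← Finset.add_sum_erase _ _ (Finset.mem_univ y),
      Finset.sum_congr rfl fun w hw => hne w (Finset.ne_of_mem_erase hw)] at h1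
    have h2 := Finset.add_sum_erase Finset.univ (fun w => if x = w then (1 : ℝ) else 0)
      (Finset.mem_univ y)
    have h3 : ∑ w, (if x = w then (1 : ℝ) else 0) = 1 := by simp
    rw [h3] at h2
    rw [Finset.sum_neg_distrib] at h1
    rw [if_pos rfl]
    linarith
  · rw [hne y hy, if_neg hy, zero_sub]

lemma lap_green (hd : 1 ≤ d) (x y : Torus d n) :
    lap (green x) y = 1 / (n : ℝ) ^ d - if x = y then 1 else 0 := by
  have hn : (n : ℝ) ≠ 0 := by exact_mod_cast NeZero.ne n
  have h : green x = fun y => 1 / (n : ℝ) ^ d * ∑ z, killedGreen z x y := rfl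
  rw [h, lap_const_mul, lap_sum]
  simp only [lap_killedGreen hd, Finset.sum_sub_distrib, Finset.sum_ite_eq, Finset.mem_univ,
    if_true, Finset.sum_const, Finset.card_univ, nsmul_eq_mul]
  rw [card_torus]
  field_simp

/-- The Green kernel `g`, normalized to have mean zero. -/
noncomputable def centredGreen (x y : Torus d n) : ℝ :=
  green x y - 1 / (n : ℝ) ^ d * ∑ z, green x z

lemma lap_centredGreen (hd : 1 ≤ d) (x y : Torus d n) :
    lap (centredGreen x) y = 1 / (n : ℝ) ^ d - if x = y then 1 else 0 := by
  have h : centredGreen x = fun y => green x y - 1 / (n : ℝ) ^ d * ∑ z, green x z := rfl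
  rw [h, lap_sub, lap_const, sub_zero, lap_green hd]

lemma sum_centredGreen (x : Torus d n) : ∑ y, centredGreen x y = 0 := by
  have hn : (n : ℝ) ≠ 0 := by exact_mod_cast NeZero.ne n
  simp only [centredGreen, Finset.sum_sub_distrib, Finset.sum_const, Finset.card_univ, nsmul_eq_mul]
  rw [card_torus]
  field_simp
  ring

/-- Green's identity for the two mean-zero kernels. Symmetry transfers the Laplace equation to the
first variable, the one on which η depends. -/
lemma centredGreen_comm (hd : 1 ≤ d) (x y : Torus d n) : centredGreen x y = centredGreen y x := by
  have h := sum_lap_mul (centredGreen x) (centredGreen y)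
  simp only [lap_centredGreen hd, sub_mul, mul_sub, Finset.sum_sub_distrib, ← Finset.mul_sum,
    ← Finset.sum_mul, sum_centredGreen, mul_zero, zero_mul, ite_mul, mul_ite, one_mul, mul_one,
    Finset.sum_ite_eq, Finset.mem_univ, if_true, zero_sub, neg_inj] at h
  exact h.symm

/-- Centring σ is the same as centring the kernel in its second variable. -/
lemma etaField_initialConfig (σ : Torus d n → ℝ) (x : Torus d n) :
    etaField (initialConfig σ) x = ∑ y, centredGreen x y * σ y := by
  have h : ∀ y, initialConfig σ y - 1 = σ y - 1 / (n : ℝ) ^ d * ∑ z, σ z := fun y => by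
    rw [initialConfig]; ring
  simp only [etaField, h, mul_sub, centredGreen, sub_mul, Finset.sum_sub_distrib]
  rw [← Finset.sum_mul, ← Finset.mul_sum]
  ring

lemma lap_centredGreen_left (hd : 1 ≤ d) (x y : Torus d n) :
    lap (fun z => centredGreen z y) x = 1 / (n : ℝ) ^ d - if y = x then 1 else 0 := by
  simp only [fun z => centredGreen_comm hd z y]
  exact lap_centredGreen hd y x

lemma initialConfig_add_lap_etaField (hd : 1 ≤ d) (σ : Torus d n → ℝ) (x : Torus d n) :
    initialConfig σ x + lap (fun y => etaField (initialConfig σ) y) x = 1 := by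
  simp only [etaField_initialConfig]
  rw [lap_sum]
  simp only [lap_mul_const, lap_centredGreen_left hd, sub_mul, Finset.sum_sub_distrib, ite_mul,
    one_mul, zero_mul, Finset.sum_ite_eq', Finset.mem_univ, if_true, ← Finset.mul_sum]
  rw [initialConfig]
  ring

lemma isBiLaplacianField_etaField (hd : 1 ≤ d) {Ω : Type*} [MeasurableSpace Ω] {P : Measure Ω}
    {σ : Torus d n → Ω → ℝ} (hind : iIndepFun σ P)
    (hlaw : ∀ x, HasLaw (σ x) (gaussianReal 0 1) P) :
    IsBiLaplacianField (fun x ω => etaField (initialConfig fun y => σ y ω) x) P := by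
  simp only [etaField_initialConfig]
  have hg : ∀ x, HasGaussianLaw (σ x) P := fun x => (hlaw x).hasGaussianLaw
  have hprob : IsProbabilityMeasure P := (hg 0).isProbabilityMeasure
  have hgauss : HasGaussianLaw (fun ω x => σ x ω) P := hind.hasGaussianLaw hg
  have hmem : ∀ x, MemLp (σ x) 2 P := fun x => (hg x).memLp_two
  have hint : ∀ x, Integrable (σ x) P := fun x => (hg x).integrable
  have hmean : ∀ x, ∫ ω, σ x ω ∂P = 0 := fun x => by
    rw [(hlaw x).integral_eq]; simp [integral_id_gaussianReal]
  have hcov : ∀ x y, ∫ ω, σ x ω * σ y ω ∂P = if x = y then 1 else 0 := by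
    intro x y
    split_ifs with hxy
    · subst hxy
      have h1 := (hlaw x).variance_eq
      rw [variance_of_integral_eq_zero (hg x).aemeasurable (hmean x),
        variance_id_gaussianReal] at h1
      simpa [pow_two] using h1
    · rw [(hind.indepFun hxy).integral_fun_mul_eq_mul_integral (hint x).aestronglyMeasurable
        (hint y).aestronglyMeasurable, hmean, zero_mul]
  refine ⟨?_, fun x => ?_, fun x y => ?_⟩
  · have := hgauss.map_fun (ContinuousLinearMap.pi fun x : Torus d n =>
      ∑ y, centredGreen x y • ContinuousLinearMap.proj (R := ℝ) (φ := fun _ : Torus d n => ℝ) y)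
    refine this.congr (Filter.Eventually.of_forall fun ω => ?_)
    ext x
    simp
  · rw [integral_finsetSum _ fun y _ => (hint y).const_mul _]
    simp [integral_const_mul, hmean]
  · have h1 : ∀ x, ∫ ω, (∑ z, centredGreen x z * σ z ω) * (∑ z, centredGreen y z * σ z ω) ∂P =
        ∑ z, centredGreen x z * centredGreen y z := by
      intro x
      simp only [Finset.sum_mul_sum, mul_mul_mul_comm (centredGreen x _) (σ _ _)]
      have hi : ∀ z w, Integrable (fun ω => centredGreen x z * centredGreen y w *
          (σ z ω * σ w ω)) P := fun z w => ((hmem z).integrable_mul (hmem w)).const_mul _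
      rw [integral_finsetSum _ fun z _ => integrable_finsetSum _ fun w _ => hi z w]
      refine Finset.sum_congr rfl fun z _ => ?_
      rw [integral_finsetSum _ fun w _ => hi z w]
      simp [integral_const_mul, hcov]
    have h2 : ∀ x, lap (fun x => ∑ z, centredGreen x z * centredGreen y z) x =
        -centredGreen x y := by
      intro x
      rw [lap_sum]
      simp only [lap_mul_const, lap_centredGreen_left hd, sub_mul, Finset.sum_sub_distrib, ite_mul,
        one_mul, zero_mul, Finset.sum_ite_eq', Finset.mem_univ, if_true, ← Finset.mul_sum,
        sum_centredGreen, mul_zero, zero_sub]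
      rw [centredGreen_comm hd]
    simp only [h1, h2]
    rw [lap_neg, lap_centredGreen_left hd, neg_sub]
    simp only [eq_comm]

end Green

/-! ### Thresholds in n, comparison with `phi`, and the final assembly. -/

section Main

/-- There is room for about √n/6 bumps of radius about 3√n, so their number is at least n^{1/4} and
its logarithm at least (log n)/4. -/
lemma le_div_sqrt_pow_four {n : ℕ} (hn : 250000 ≤ n) :
    n ≤ (n / (2 * (3 * (Nat.sqrt n + 1) + 1))) ^ 4 := by
  set s := Nat.sqrt n with hs
  have hs500 : 500 ≤ s := Nat.le_sqrt.2 (by omega)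
  have h1 : s * s ≤ n := Nat.sqrt_le n
  have h2 : n < (s + 1) * (s + 1) := Nat.lt_succ_sqrt n
  have hu7 : s / 7 * 7 ≤ s := Nat.div_mul_le_self s 7
  have hu : s / 7 ≤ n / (2 * (3 * (s + 1) + 1)) := by
    rw [Nat.le_div_iff_mul_le (by omega)]
    nlinarith
  refine le_trans ?_ (Nat.pow_le_pow_left hu 4)
  have h3 : s ≤ 7 * (s / 7) + 6 := by omega
  have h4 : 70 ≤ s / 7 := by omega
  set u := s / 7
  have h5 : (s + 1) * (s + 1) ≤ (7 * u + 7) * (7 * u + 7) := Nat.mul_le_mul (by omega) (by omega)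
  have h6 : 7 * u + 7 ≤ u * u := by nlinarith
  calc n ≤ (7 * u + 7) * (7 * u + 7) := by omega
    _ ≤ (u * u) * (u * u) := Nat.mul_le_mul h6 h6
    _ = u ^ 4 := by ring

lemma exists_threshold : ∃ N : ℕ, 2 ≤ N ∧ ∀ n : ℕ, N ≤ n →
    n ≤ (n / (2 * (3 * (Nat.sqrt n + 1) + 1))) ^ 4 ∧ n ≤ (n / 4) ^ 4 ∧ 144 ≤ Real.log n := by
  have hlog : ∀ᶠ n : ℕ in Filter.atTop, (144 : ℝ) ≤ Real.log n :=
    (Real.tendsto_log_atTop.comp tendsto_natCast_atTop_atTop).eventually_ge_atTop 144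
  obtain ⟨N, hN⟩ := Filter.eventually_atTop.1 hlog
  refine ⟨max N 250000, by omega, fun n hn => ?_⟩
  have h1 := le_div_sqrt_pow_four (n := n) (by omega)
  refine ⟨h1, h1.trans (Nat.pow_le_pow_left (Nat.div_le_div_left (by omega) (by norm_num)) 4),
    hN n (by omega)⟩

lemma sqrt_eq_phi {d n : ℕ} (hn : 2 ≤ n) (hd : d < 4) :
    √(1 / (n : ℝ) ^ d * n ^ 4) = phi d n := by
  have hn0 : (0 : ℝ) < n := by positivity
  rw [phi, if_pos hd, Real.sqrt_eq_iff_mul_self_eq (by positivity) (by positivity),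
    ← Real.rpow_add hn0, one_div, inv_mul_eq_div, div_eq_iff (by positivity), ← Real.rpow_natCast,
    ← Real.rpow_natCast, ← Real.rpow_add hn0]
  congr 1
  push_cast
  ring

lemma phi_nonneg {d n : ℕ} (hn : 2 ≤ n) : 0 ≤ phi d n := by
  have : 0 ≤ Real.log n := Real.log_natCast_nonneg n
  unfold phi
  split_ifs <;> positivity

lemma phi_four (n : ℕ) : phi 4 n = Real.log n := by simp [phi]

lemma phi_of_five_le {d : ℕ} (hd : 5 ≤ d) (n : ℕ) : phi d n = √(Real.log n) := by
  rw [phi, if_neg (by omega), if_neg (by omega), Real.sqrt_eq_rpow]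

lemma phi_mono {d m n : ℕ} (hd : 4 ≤ d) (hm : 2 ≤ m) (hmn : m ≤ n) : phi d m ≤ phi d n := by
  have h1 : Real.log m ≤ Real.log n :=
    Real.log_le_log (by positivity) (by exact_mod_cast hmn)
  rcases hd.eq_or_lt with rfl | hd
  · rwa [phi_four, phi_four]
  · rw [phi_of_five_le hd, phi_of_five_le hd]
    exact Real.sqrt_le_sqrt h1

lemma phi_pos {d n : ℕ} (hd : 4 ≤ d) (hn : 2 ≤ n) : 0 < phi d n := by
  have h1 : 0 < Real.log n := Real.log_pos (by exact_mod_cast hn)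
  rcases hd.eq_or_lt with rfl | hd
  · rwa [phi_four]
  · rw [phi_of_five_le hd]
    exact Real.sqrt_pos.2 h1

universe u

/-- `φ_d(n)` is, up to constants, a lower bound for the expected maximum of every discrete
bi-Laplacian field. -/
lemma exists_lower_bound (d : ℕ) (hd : 1 ≤ d) :
    ∃ c : ℝ, 0 < c ∧ ∀ (n : ℕ) [NeZero n], 2 ≤ n → ∀ (Ω : Type u) [MeasurableSpace Ω]
      (P : Measure Ω) [IsProbabilityMeasure P] (η : Torus d n → Ω → ℝ), IsBiLaplacianField η P →
      c * phi d n ≤ ∫ ω, ⨆ x, η x ω ∂P := by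
  have hm := absMoment_pos
  rcases lt_or_ge d 4 with hd4 | hd4
  · refine ⟨absMoment / 40, by positivity, fun n _ hn Ω _ P _ η h => ?_⟩
    rw [← sqrt_eq_phi hn hd4]
    exact h.integral_iSup_ge hd hn
  obtain ⟨N, hN2, hN⟩ := exists_threshold
  have hφ : 0 < phi d N := phi_pos hd4 hN2
  have hN0 : (0 : ℝ) < N := by positivity
  -- For n < N the two-point bound is used: there it is at least a positive constant, while `phi d
  -- n` ≤ `phi d N`.
  set c₁ := absMoment / 40 * √(1 / (N : ℝ) ^ d) / phi d N with hc₁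
  have hc₁0 : 0 < c₁ := by
    have : 0 < √(1 / (N : ℝ) ^ d) := Real.sqrt_pos.2 (by positivity)
    positivity
  refine ⟨min c₁ (1 / 800000), lt_min hc₁0 (by norm_num), fun n _ hn Ω _ P _ η h => ?_⟩
  have hφn := phi_nonneg (d := d) hn
  rcases lt_or_ge n N with hnN | hnN
  · refine le_trans ?_ (h.integral_iSup_ge hd hn)
    calc min c₁ (1 / 800000) * phi d n ≤ c₁ * phi d N := by
          gcongr
          · exact min_le_left _ _
          · exact phi_mono hd4 hn hnN.le
      _ = absMoment / 40 * √(1 / (N : ℝ) ^ d) := by rw [hc₁, div_mul_cancel₀ _ hφ.ne']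
      _ ≤ _ := by
          gcongr
          have h1 : (1 : ℝ) ≤ (n : ℝ) ^ 4 := one_le_pow₀ (by exact_mod_cast (by omega : 1 ≤ n))
          have h2 : (n : ℝ) ≤ N := by exact_mod_cast hnN.le
          have h3 : (0 : ℝ) < n := by positivity
          calc 1 / (N : ℝ) ^ d ≤ 1 / (n : ℝ) ^ d := by gcongr
            _ = 1 / (n : ℝ) ^ d * 1 := (mul_one _).symm
            _ ≤ _ := by gcongr
  · obtain ⟨h1, h2, h3⟩ := hN n hnN
    refine le_trans (mul_le_mul_of_nonneg_right (min_le_right _ _) hφn) ?_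
    rcases hd4.eq_or_lt with rfl | hd5
    · rw [phi_four]
      exact h.integral_iSup_ge_log h1 h3
    · rw [phi_of_five_le hd5]
      refine le_trans ?_ (h.integral_iSup_ge_sqrt_log hd h2 h3)
      gcongr
      norm_num

/-- `φ_d(n)` is, up to constants, an upper bound for the expected maximum of every discrete
bi-Laplacian field. -/
lemma exists_upper_bound (d : ℕ) (hd : 1 ≤ d) :
    ∃ A : ℝ, ∀ (n : ℕ) [NeZero n], 2 ≤ n → ∀ (Ω : Type u) [MeasurableSpace Ω]
      (P : Measure Ω) [IsProbabilityMeasure P] (η : Torus d n → Ω → ℝ), IsBiLaplacianField η P →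
      ∫ ω, ⨆ x, η x ω ∂P ≤ A * phi d n := by
  rcases lt_or_ge d 4 with hd4 | hd4
  · refine ⟨10 * √(16 * 400000 * 3), fun n _ hn Ω _ P _ η h => ?_⟩
    rw [← sqrt_eq_phi hn hd4]
    exact h.integral_iSup_le_of_le_three hd (by omega) hn
  rcases hd4.eq_or_lt with rfl | hd5
  · refine ⟨√(2 * (4 * 16384) * 4), fun n _ hn Ω _ P _ η h => ?_⟩
    have hlog : 0 < Real.log n := Real.log_pos (by exact_mod_cast hn)
    refine (h.integral_iSup_le_of_kern_le hd hn (by positivity)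
      (kern_two_zero_le_four hn)).trans (le_of_eq ?_)
    rw [phi_four]
    rw [show 2 * (4 * (16384 * Real.log n)) * (((4 : ℕ) : ℝ) * Real.log n) =
      2 * (4 * 16384) * 4 * Real.log n ^ 2 by push_cast; ring, Real.sqrt_mul (by norm_num),
      Real.sqrt_sq hlog.le]
  · refine ⟨√(2 * (4 * ((d : ℝ) ^ 2 * 4 ^ d * 2)) * d), fun n _ hn Ω _ P _ η h => ?_⟩
    have hd0 : (0 : ℝ) < d := by exact_mod_cast hd
    refine (h.integral_iSup_le_of_kern_le hd hn (by positivity)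
      (kern_two_zero_le_of_five_le hd5)).trans (le_of_eq ?_)
    rw [phi_of_five_le hd5, ← mul_assoc, Real.sqrt_mul (by positivity)]

variable {d n : ℕ} [NeZero n] {Ω : Type*} [MeasurableSpace Ω] {P : Measure Ω}
  {η : Torus d n → Ω → ℝ}

/-- -min η = max(-η), and the centred term η(x) drops out, so the result is the same at every site.
-/
lemma IsBiLaplacianField.lintegral_sub_iInf (h : IsBiLaplacianField η P) (x : Torus d n) :
    ∫⁻ ω, ENNReal.ofReal (η x ω - ⨅ y, η y ω) ∂P =
      ENNReal.ofReal (∫ ω, ⨆ y, -η y ω ∂P) := by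
  have h1 : ∀ ω, η x ω - ⨅ y, η y ω = η x ω + ⨆ y, -η y ω := fun ω => by
    have h2 := Real.mul_iInf_of_nonpos (r := -1) (by norm_num) fun y => η y ω
    simp only [neg_one_mul] at h2
    rw [← h2, sub_eq_add_neg]
  have h2 : ∫ ω, ⨆ y, -η y ω ∂P = ∫ ω, (η x ω - ⨅ y, η y ω) ∂P := by
    simp only [h1]
    rw [integral_add (h.integrable x) h.neg.integrable_iSup, h.centred, zero_add]
  rw [h2, ofReal_integral_eq_lintegral_ofReal]
  · simp only [h1]
    exact (h.integrable x).add h.neg.integrable_iSup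
  · exact Filter.Eventually.of_forall fun ω =>
      sub_nonneg.2 (ciInf_le (Set.finite_range fun y => η y ω).bddBelow x)

end Main
end Sandpile

theorem mainTheorem4 (d : ℕ) (hd : 1 ≤ d) :
    ∃ C : ℝ, 0 < C ∧ ∀ (n : ℕ) [NeZero n], 2 ≤ n →
      ∀ (Ω : Type*) [MeasurableSpace Ω] (P : Measure Ω) [IsProbabilityMeasure P],
        -- the sandpile odometer and the associated field
        (∀ σ : Sandpile.Torus d n → Ω → ℝ,
          iIndepFun σ P → (∀ x, HasLaw (σ x) (gaussianReal 0 1) P) →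
          (∀ x : Sandpile.Torus d n,
            ENNReal.ofReal (C⁻¹ * Sandpile.phi d n) ≤
              ∫⁻ ω, Sandpile.odometerLimit (Sandpile.initialConfig (fun y => σ y ω)) x ∂P ∧
            ∫⁻ ω, Sandpile.odometerLimit (Sandpile.initialConfig (fun y => σ y ω)) x ∂P ≤
              ENNReal.ofReal (C * Sandpile.phi d n)) ∧
          Integrable
            (fun ω => ⨆ x, Sandpile.etaField (Sandpile.initialConfig (fun y => σ y ω)) x) P ∧
          C⁻¹ * Sandpile.phi d n ≤
            ∫ ω, (⨆ x, Sandpile.etaField (Sandpile.initialConfig (fun y => σ y ω)) x) ∂P ∧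
          ∫ ω, (⨆ x, Sandpile.etaField (Sandpile.initialConfig (fun y => σ y ω)) x) ∂P ≤
            C * Sandpile.phi d n) ∧
        -- every discrete bi-Laplacian field on the torus
        (∀ η : Sandpile.Torus d n → Ω → ℝ, Sandpile.IsBiLaplacianField η P →
          Integrable (fun ω => ⨆ x, η x ω) P ∧
          C⁻¹ * Sandpile.phi d n ≤ ∫ ω, (⨆ x, η x ω) ∂P ∧
          ∫ ω, (⨆ x, η x ω) ∂P ≤ C * Sandpile.phi d n) := by
  obtain ⟨c, hc, hlow⟩ := Sandpile.exists_lower_bound d hd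
  obtain ⟨A, hup⟩ := Sandpile.exists_upper_bound d hd
  have hC : 0 < max c⁻¹ A := lt_max_of_lt_left (inv_pos.2 hc)
  refine ⟨max c⁻¹ A, hC, fun n _ hn Ω _ P _ => ?_⟩
  have hφ := Sandpile.phi_nonneg (d := d) hn
  have key : ∀ η : Sandpile.Torus d n → Ω → ℝ, Sandpile.IsBiLaplacianField η P →
      (max c⁻¹ A)⁻¹ * Sandpile.phi d n ≤ ∫ ω, (⨆ x, η x ω) ∂P ∧
      ∫ ω, (⨆ x, η x ω) ∂P ≤ max c⁻¹ A * Sandpile.phi d n := by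
    intro η h
    refine ⟨(mul_le_mul_of_nonneg_right ?_ hφ).trans (hlow n hn Ω P η h),
      (hup n hn Ω P η h).trans (mul_le_mul_of_nonneg_right (le_max_right _ _) hφ)⟩
    exact inv_le_of_inv_le₀ hc (le_max_left _ _)
  refine ⟨fun σ hind hlaw => ?_, fun η h => ⟨h.integrable_iSup, key η h⟩⟩
  have h := Sandpile.isBiLaplacianField_etaField hd hind hlaw
  refine ⟨fun x => ?_, h.integrable_iSup, key _ h⟩
  simp only [Sandpile.odometerLimit_eq hd (Sandpile.initialConfig_add_lap_etaField hd _)]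
  rw [h.lintegral_sub_iInf x]
  -- The odometer is governed by max(-η), so the bounds are applied to the field -η.
  obtain ⟨h1, h2⟩ := key _ h.neg
  exact ⟨ENNReal.ofReal_le_ofReal h1, ENNReal.ofReal_le_ofReal h2⟩
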